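/- **Conventions.** All Hilbert spaces are finite-dimensional complex Hilbert spaces. A matrix algebra on $\mathcal H$ is a unital $*$-subalgebra of $\mathcal B(\mathcal H)$. A state on it is an element $\omega\ge 0$ with $\operatorname{tr}\omega=1$; its support is $(\ker\omega)^\perp$. For a positive semidefinite $A$, negative powers $A^{-1}$, $A^{-1/2}$ are taken on the support of $A$ and are $0$ on $\ker A$ (so $A^{-1}$ is the Moore–Penrose inverse). $\|\cdot\|_\infty$ is the operator norm, $\|A\|_2=\operatorname{tr}[A^*A]^{1/2}$. For positive definite $\sigma,\rho$ the BS-entropy is $\hat S_{\mathrm{BS}}(\sigma\|\rho)=-\operatorname{tr}[\sigma\log(\sigma^{-1/2}\rho\,\sigma^{-1/2})]$; for general positive semidefinite arguments it is $\lim_{\varepsilon\searrow0}\hat S_{\mathrm{BS}}(\sigma+\varepsilon I\|\rho+\varepsilon I)$. **Theorem.** Let $\mathcal M\subseteq\mathcal B(\mathcal H)$ and $\mathcal N\subseteq\mathcal B(\mathcal K)$ be matrix algebras and let $\mathcal T:\mathcal M\to\mathcal N$ be a completely positive trace-preserving linear map, with adjoint $\mathcal T^*:\mathcal N\to\mathcal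 M$ for the Hilbert–Schmidt inner products $\langle A,B\rangle=\operatorname{tr}[A^*B]$. Let $\sigma,\rho$ be states on $\mathcal M$ with equal support, and put $\sigma_{\mathcal T}=\mathcal T(\sigma)$, $\rho_{\mathcal T}=\mathcal T(\rho)$, $\Gamma=\sigma^{-1/2}\rho\,\sigma^{-1/2}$, $\Gamma_{\mathcal T}=\sigma_{\mathcal T}^{-1/2}\rho_{\mathcal T}\,\sigma_{\mathcal T}^{-1/2}$. Then the limits $\lim_{\varepsilon\searrow0}\hat S_{\mathrm{BS}}(\sigma+\varepsilon I\|\rho+\varepsilon I)$ and $\lim_{\varepsilon\searrow0}\hat S_{\mathrm{BS}}(\sigma_{\mathcal T}+\varepsilon I\|\rho_{\mathcal T}+\varepsilon I)$ exist, are finite, and equal $\hat S_{\mathrm{BS}}(\sigma\|\rho)$ and $\hat S_{\mathrm{BS}}(\sigma_{\mathcal T}\|\rho_{\mathcal T})$, and the following hold. 1. For every finite-dimensional Hilbert space $\mathcal V$ and every isometry $V:\mathcal H\to\mathcal K\otimes\mathcal V$ with $\mathcal T(\omega)=\operatorname{tr}_{\mathcal V}[V\omega V^*]$ for all states $\omega$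 on $\mathcal M$ (a Stinespring dilation of $\mathcal T$), $$\hat S_{\mathrm{BS}}(\sigma\|\rho)-\hat S_{\mathrm{BS}}(\sigma_{\mathcal T}\|\rho_{\mathcal T})\ \ge\ \Big(\frac{\pi}{4}\Big)^4\|\Gamma\|_\infty^{-2}\,\Big\|V\sigma^{1/2}V^*\big((\sigma_{\mathcal T}^{-1/2}\,\Gamma_{\mathcal T}^{1/2}\,\sigma_{\mathcal T}^{1/2})\otimes I\big)-V\,\Gamma^{1/2}\sigma^{1/2}\,V^*\Big\|_2^4 .$$ 2. Moreover, $$\hat S_{\mathrm{BS}}(\sigma\|\rho)-\hat S_{\mathrm{BS}}(\sigma_{\mathcal T}\|\rho_{\mathcal T})\ \ge\ \Big(\frac{\pi}{8}\Big)^4\|\Gamma\|_\infty^{-4}\,\|\sigma_{\mathcal T}^{-1}\|_\infty^{-2}\,\big\|\sigma\,\mathcal T^*(\sigma_{\mathcal T}^{-1}\rho_{\mathcal T})-\rho\big\|_2^4 .$$ -/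

import Mathlib

open scoped Matrix ComplexOrder Kronecker Topology
open Filter

namespace BSChannel

noncomputable section

/-! Operators on `ℂⁿ` are matrices indexed by a finite type `n`; a matrix algebra is a unital
`*`-subalgebra of all these matrices. -/

/-- Density matrices: positive semidefinite with trace one. -/
def IsState {n : Type*} [Fintype n] (ρ : Matrix n n ℂ) : Prop :=
  ρ.PosSemidef ∧ ρ.trace = 1

/-- The support of `A`: the orthogonal complement of its kernel. -/
def support {n : Type*} [Fintype n] [DecidableEq n] (A : Matrix n n ℂ) :
    Submodule ℂ (EuclideanSpace ℂ n) :=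
  (LinearMap.ker (Matrix.toEuclideanLin A))ᗮ

/-- The real power `A ^ s` of a positive semidefinite matrix, by functional calculus. Since
`0 ^ s = 0` for real `s ≠ 0`, negative powers invert `A` on its support and vanish on its kernel. -/
def psdPow {n : Type*} [Fintype n] [DecidableEq n] (A : Matrix n n ℂ) (s : ℝ) : Matrix n n ℂ :=
  cfc (fun x : ℝ => x ^ s) A

/-- The Moore-Penrose inverse of a Hermitian matrix, by functional calculus (`0⁻¹ = 0`). -/
def mpInv {n : Type*} [Fintype n] [DecidableEq n] (A : Matrix n n ℂ) : Matrix n n ℂ :=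
  cfc (fun x : ℝ => x⁻¹) A

/-- `Γ = σ^{-1/2} ρ σ^{-1/2}`. -/
def gam {n : Type*} [Fintype n] [DecidableEq n] (σ ρ : Matrix n n ℂ) : Matrix n n ℂ :=
  psdPow σ (-1 / 2) * ρ * psdPow σ (-1 / 2)

/-- The operator norm (Schatten `∞`-norm) with respect to the Euclidean norm. -/
def opNorm {n : Type*} [Fintype n] [DecidableEq n] (A : Matrix n n ℂ) : ℝ :=
  ‖Matrix.toEuclideanCLM (n := n) (𝕜 := ℂ) A‖

/-- The Hilbert-Schmidt norm (Schatten `2`-norm) `tr[A* A]^{1/2}`. -/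
def hsNorm {n : Type*} [Fintype n] (A : Matrix n n ℂ) : ℝ :=
  √((Aᴴ * A).trace.re)

/-- The expression `-tr[σ log(σ^{-1/2} ρ σ^{-1/2})]` for positive definite `σ`, `ρ`. -/
def bsFormula {n : Type*} [Fintype n] [DecidableEq n] (σ ρ : Matrix n n ℂ) : ℝ :=
  -((σ * cfc Real.log (gam σ ρ)).trace.re)

/-- The regularized expression at `σ + ε I`, `ρ + ε I`. -/
def bsRegularized {n : Type*} [Fintype n] [DecidableEq n] (σ ρ : Matrix n n ℂ) (ε : ℝ) : ℝ :=
  bsFormula (σ + (ε : ℂ) • (1 : Matrix n n ℂ)) (ρ + (ε : ℂ) • (1 : Matrix n n ℂ))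

open Classical in
/-- The BS-entropy: given by the formula for positive definite arguments, and by the limit
`ε ↘ 0` of the regularized expressions otherwise. -/
def bsEntropy {n : Type*} [Fintype n] [DecidableEq n] (σ ρ : Matrix n n ℂ) : ℝ :=
  if σ.PosDef ∧ ρ.PosDef then bsFormula σ ρ
  else limUnder (𝓝[>] (0 : ℝ)) (bsRegularized σ ρ)

/-- Completely positive trace-preserving maps between matrix algebras. An element of
`M ⊗ M_m(ℂ)` is given by its `m × m` array `X` of entries in `M`; `Matrix.comp` turns the array
into the corresponding matrix on `ℂᵐ ⊗ ℂⁿ`. -/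
structure IsQuantumChannel {n k : Type*} [Fintype n] [DecidableEq n] [Fintype k] [DecidableEq k]
    {M : StarSubalgebra ℂ (Matrix n n ℂ)} {N : StarSubalgebra ℂ (Matrix k k ℂ)}
    (T : M →ₗ[ℂ] N) : Prop where
  completelyPositive : ∀ (m : ℕ) (X : Matrix (Fin m) (Fin m) M),
    (Matrix.comp (Fin m) (Fin m) n n ℂ (X.map fun a => (a : Matrix n n ℂ))).PosSemidef →
    (Matrix.comp (Fin m) (Fin m) k k ℂ (X.map fun a => (T a : Matrix k k ℂ))).PosSemidef
  tracePreserving : ∀ A : M, (T A : Matrix k k ℂ).trace = (A : Matrix n n ℂ).trace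

/-- The partial trace over the second tensor factor. -/
def partialTrace {k v : Type*} [Fintype v] (X : Matrix (k × v) (k × v) ℂ) : Matrix k k ℂ :=
  Matrix.of fun i j => ∑ a : v, X (i, a) (j, a)

/-- `V : ℂⁿ → ℂᵏ ⊗ ℂᵛ` is an isometry and `T ω = tr_v[V ω V*]` for all states `ω` of `M`. -/
def IsStinespringIsometry {n k v : Type*} [Fintype n] [DecidableEq n] [Fintype k] [DecidableEq k]
    [Fintype v] {M : StarSubalgebra ℂ (Matrix n n ℂ)} {N : StarSubalgebra ℂ (Matrix k k ℂ)}
    (T : M →ₗ[ℂ] N) (V : Matrix (k × v) n ℂ) : Prop :=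
  Vᴴ * V = 1 ∧ ∀ ω : M, IsState (ω : Matrix n n ℂ) →
    (T ω : Matrix k k ℂ) = partialTrace (V * (ω : Matrix n n ℂ) * Vᴴ)

/-- The Hilbert-Schmidt inner product `⟨A, B⟩ = tr[A* B]` on a matrix algebra. -/
@[reducible]
def hsCore {n : Type*} [Fintype n] [DecidableEq n] (M : StarSubalgebra ℂ (Matrix n n ℂ)) :
    InnerProductSpace.Core ℂ M where
  inner A B := ((A : Matrix n n ℂ)ᴴ * (B : Matrix n n ℂ)).trace
  conj_inner_symm A B := by
    rw [starRingEnd_apply, ← Matrix.trace_conjTranspose]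
    simp
  re_inner_nonneg A :=
    (Complex.le_def.1 (Matrix.posSemidef_conjTranspose_mul_self (A : Matrix n n ℂ)).trace_nonneg).1
  add_left A B C := by simp [Matrix.add_mul]
  smul_left A B r := by simp
  definite A h := Subtype.ext (Matrix.trace_conjTranspose_mul_self_eq_zero_iff.1 h)

/-- The adjoint `T* : N → M` of `T : M → N` for the Hilbert-Schmidt inner products. -/
def hsAdjoint {n k : Type*} [Fintype n] [DecidableEq n] [Fintype k] [DecidableEq k]
    {M : StarSubalgebra ℂ (Matrix n n ℂ)} {N : StarSubalgebra ℂ (Matrix k k ℂ)}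
    (T : M →ₗ[ℂ] N) : N →ₗ[ℂ] M :=
  letI : NormedAddCommGroup M := (hsCore M).toNormedAddCommGroup
  letI : InnerProductSpace ℂ M := InnerProductSpace.ofCore (hsCore M).toCore
  letI : NormedAddCommGroup N := (hsCore N).toNormedAddCommGroup
  letI : InnerProductSpace ℂ N := InnerProductSpace.ofCore (hsCore N).toCore
  haveI : FiniteDimensional ℂ M :=
    inferInstanceAs (FiniteDimensional ℂ (Subalgebra.toSubmodule M.toSubalgebra))
  haveI : FiniteDimensional ℂ N :=
    inferInstanceAs (FiniteDimensional ℂ (Subalgebra.toSubmodule N.toSubalgebra))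
  LinearMap.adjoint T

/-- `⟨T* B, A⟩ = ⟨B, T A⟩`. -/
theorem hsAdjoint_spec {n k : Type*} [Fintype n] [DecidableEq n] [Fintype k] [DecidableEq k]
    {M : StarSubalgebra ℂ (Matrix n n ℂ)} {N : StarSubalgebra ℂ (Matrix k k ℂ)}
    (T : M →ₗ[ℂ] N) (B : N) (A : M) :
    ((hsAdjoint T B : Matrix n n ℂ)ᴴ * (A : Matrix n n ℂ)).trace =
      ((B : Matrix k k ℂ)ᴴ * (T A : Matrix k k ℂ)).trace := by
  let : NormedAddCommGroup M := (hsCore M).toNormedAddCommGroup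
  let : InnerProductSpace ℂ M := InnerProductSpace.ofCore (hsCore M).toCore
  let : NormedAddCommGroup N := (hsCore N).toNormedAddCommGroup
  let : InnerProductSpace ℂ N := InnerProductSpace.ofCore (hsCore N).toCore
  have : FiniteDimensional ℂ M :=
    inferInstanceAs (FiniteDimensional ℂ (Subalgebra.toSubmodule M.toSubalgebra))
  have : FiniteDimensional ℂ N :=
    inferInstanceAs (FiniteDimensional ℂ (Subalgebra.toSubmodule N.toSubalgebra))
  exact LinearMap.adjoint_inner_left T A B

/-- A matrix algebra contains the Moore-Penrose inverses of its elements. -/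
theorem mpInv_mem {n : Type*} [Fintype n] [DecidableEq n]
    {M : StarSubalgebra ℂ (Matrix n n ℂ)} {A : Matrix n n ℂ} (hA : A ∈ M) : mpInv A ∈ M := by
  have : IsClosed (M : Set (Matrix n n ℂ)) :=
    Submodule.closed_of_finiteDimensional (Subalgebra.toSubmodule M.toSubalgebra)
  exact cfc_mem (𝕜' := ℂ) _ hA

/-- The Moore-Penrose inverse as an element of the matrix algebra. -/
def mpInvIn {n : Type*} [Fintype n] [DecidableEq n] {M : StarSubalgebra ℂ (Matrix n n ℂ)}
    (A : M) : M :=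
  ⟨mpInv (A : Matrix n n ℂ), mpInv_mem A.2⟩

end

end BSChannel

/-! Write `U = V σ^{1/2}`, `τ = T σ`, `θ = T ρ`, so that `U U*` and `U Γ U*` have partial traces `τ`
and `θ`. For a function `f` compare `U f(Γ)` with `(τ^{1/2} f(Γ_T) τ^{-1/2} ⊗ 1) U`; the difference
is `funcGap`. At `f = √` it is, up to an adjoint, a sign and the isometry `V`, the operator in the
first bound.

The key is an exact computation for resolvents (`funcGap_resolvent`): if `W` is the gap at `x ↦ (x +
t)⁻¹`, then `tr[W (Γ + t) W*]` equals the difference of the two expectations of the resolvent, and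
`Γ ≥ 0` turns this into a bound on `t ‖W‖₂²`. Integrating the difference of expectations over `t`
gives the difference of the BS-entropies, since `-log x` is the integral of `(x + t)⁻¹ - (1 + t)⁻¹`.
Since `π √x` is the integral of `√t (t⁻¹ - (x + t)⁻¹)` and constants have zero gap, the gap at `√`
is an integral of resolvent gaps. Cauchy-Schwarz controls this integral on `(0, T]`, the bound `Γ,
Γ_T ≤ ‖Γ‖` controls its tail, and the best `T` yields the fourth power and the constant `256 = 4⁴`
(`pow_four_funcGap_sqrt_le`).

For the second bound, `σ_T⁻¹ ρ_T` is the square of `b = τ^{-1/2} Γ_T^{1/2} τ^{1/2}`, and the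
recovery error computed with the full dilation factors as a difference of squares through the
square-root gap (`norm_vec_recovery_le`). The adjoint of `T` on `M` is the Hilbert-Schmidt
projection of the dilated adjoint, so passing to it cannot increase the error
(`hsNorm_recovery_le`). A dilation exists because the Choi matrix of `T` composed with the
projection onto `M` is positive (`exists_stinespring`).

Equal supports give domination of each state by a multiple of the other. Completely positive maps
preserve domination, which makes the logarithms harmless at eigenvalue `0` and the `ε`-limits
finite. -/

namespace BSChannel

set_option linter.unusedSectionVars false

/-! ### Integral representations and the scalar optimization -/

section Integrals

open MeasureTheory Set

/-- The substitution `t = x²` turns the integrand into `2 / (1 + x²)`. This is the constant in the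
integral representation of the square root. -/
theorem integral_rpowIntegrand_half_one :
    ∫ t in Ioi (0 : ℝ), Real.rpowIntegrand₀₁ (1 / 2) t 1 = Real.pi := by
  rw [← integral_comp_rpow_Ioi_of_pos (g := fun t => Real.rpowIntegrand₀₁ (1 / 2) t 1)
    (p := 2) two_pos]
  have h : ∀ x ∈ Ioi (0 : ℝ),
      ((2 : ℝ) * x ^ ((2 : ℝ) - 1)) • Real.rpowIntegrand₀₁ (1 / 2) (x ^ (2 : ℝ)) 1 =
        2 * (1 + x ^ 2)⁻¹ := by
    intro x hx
    have hx : 0 < x := hx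
    have h1 : ((2 : ℝ) - 1) = 1 := by norm_num
    have h2 : (x ^ (2 : ℝ)) ^ (1 / 2 : ℝ) = x := by
      rw [← Real.rpow_mul hx.le]; norm_num
    rw [Real.rpowIntegrand₀₁, h2, h1, Real.rpow_one, Real.rpow_two, smul_eq_mul]
    field_simp
    ring
  rw [setIntegral_congr_fun measurableSet_Ioi h, integral_const_mul, integral_Ioi_inv_one_add_sq]
  simp
  ring

theorem integrableOn_sqrt_mul_inv_sub_inv {x : ℝ} (hx : 0 ≤ x) :
    IntegrableOn (fun t => √t * (t⁻¹ - (x + t)⁻¹)) (Ioi 0) := by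
  have := Real.integrableOn_rpowIntegrand₀₁_Ioi (p := 1 / 2) ⟨by norm_num, by norm_num⟩ hx
  refine this.congr_fun (fun t _ => ?_) measurableSet_Ioi
  simp [Real.rpowIntegrand₀₁, Real.sqrt_eq_rpow, add_comm]

theorem integral_sqrt_mul_inv_sub_inv {x : ℝ} (hx : 0 ≤ x) :
    ∫ t in Ioi (0 : ℝ), √t * (t⁻¹ - (x + t)⁻¹) = Real.pi * √x := by
  have := Real.integral_rpowIntegrand₀₁_eq_rpow_mul_const (p := 1 / 2)
    ⟨by norm_num, by norm_num⟩ hx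
  rw [integral_rpowIntegrand_half_one, ← Real.sqrt_eq_rpow, mul_comm] at this
  rw [← this]
  refine setIntegral_congr_fun measurableSet_Ioi (fun t _ => ?_)
  simp [Real.rpowIntegrand₀₁, Real.sqrt_eq_rpow, add_comm]

/-- An antiderivative is `log (x + t) - log (1 + t)`, which tends to `0` at infinity and equals `log
x` at `0`. The integrand has constant sign on each side of `x = 1`, and this gives integrability. -/
theorem integral_inv_sub_inv_log {x : ℝ} (hx : 0 < x) :
    IntegrableOn (fun t => (x + t)⁻¹ - (1 + t)⁻¹) (Ioi 0) ∧
      ∫ t in Ioi (0 : ℝ), ((x + t)⁻¹ - (1 + t)⁻¹) = -Real.log x := by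
  have hd : ∀ t ∈ Ici (0 : ℝ), HasDerivAt (fun t => Real.log (x + t) - Real.log (1 + t))
      ((x + t)⁻¹ - (1 + t)⁻¹) t := by
    intro t ht
    have ht : 0 ≤ t := ht
    have h1 : HasDerivAt (fun t => x + t) 1 t := (hasDerivAt_id t).const_add x
    have h2 : HasDerivAt (fun t => 1 + t) 1 t := (hasDerivAt_id t).const_add 1
    simpa using (h1.log (by positivity)).fun_sub (h2.log (by positivity))
  have hl : Tendsto (fun t => Real.log (x + t) - Real.log (1 + t)) atTop (𝓝 0) := by
    have h1 : Tendsto (fun t : ℝ => 1 + (x - 1) * (1 + t)⁻¹) atTop (𝓝 (1 + (x - 1) * 0)) :=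
      ((tendsto_inv_atTop_zero.comp (tendsto_atTop_add_const_left _ 1 tendsto_id)).const_mul
        _).const_add _
    have h2 := h1.log (by simp)
    simp only [mul_zero, add_zero, Real.log_one] at h2
    refine h2.congr' ?_
    filter_upwards [eventually_gt_atTop 0] with t ht
    rw [← Real.log_div (by positivity) (by positivity)]
    congr 1
    field_simp
    ring
  have hi : IntegrableOn (fun t => (x + t)⁻¹ - (1 + t)⁻¹) (Ioi 0) := by
    rcases le_total x 1 with h | h
    · refine integrableOn_Ioi_deriv_of_nonneg' hd (fun t ht => ?_) hl
      have ht : 0 < t := ht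
      rw [sub_nonneg]
      gcongr
    · refine integrableOn_Ioi_deriv_of_nonpos' hd (fun t ht => ?_) hl
      have ht : 0 < t := ht
      rw [sub_nonpos]
      gcongr
  refine ⟨hi, ?_⟩
  rw [integral_Ioi_of_hasDerivAt_of_tendsto' hd hi hl]
  simp

/-- Splitting the integral of `h` at `T` and optimizing over `T`. -/
theorem pow_four_integral_norm_le {E : Type*} [NormedAddCommGroup E] [NormedSpace ℝ E]
    {h : ℝ → E} {d : ℝ → ℝ} {L : ℝ} (hL : 0 ≤ L)
    (hh : IntegrableOn h (Ioi 0)) (hd : IntegrableOn d (Ioi 0))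
    (hle : ∀ t > 0, ‖h t‖ ^ 2 ≤ d t) (htail : ∀ t > 0, ‖h t‖ ≤ 2 * L * t ^ (-(3 / 2) : ℝ)) :
    ‖∫ t in Ioi 0, h t‖ ^ 4 ≤ 256 * L ^ 2 * ∫ t in Ioi 0, d t := by
  set D := ∫ t in Ioi 0, d t with hD
  set X := ‖∫ t in Ioi 0, h t‖ with hX
  have hd0 : ∀ t ∈ Ioi (0 : ℝ), 0 ≤ d t := fun t ht => (sq_nonneg _).trans (hle t ht)
  have hD0 : 0 ≤ D := setIntegral_nonneg measurableSet_Ioi hd0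
  -- On `(0, T]` the inequality `y ≤ (s / 2) y² + 1 / (2 s)` does the work of Cauchy-Schwarz without
  -- dividing by `D`; beyond `T` the tail bound integrates to `4 L T^{-1/2}`.
  have key : ∀ T > 0, ∀ s > 0, X ≤ s * D / 2 + T / (2 * s) + 4 * L * T ^ (-(1 / 2) : ℝ) := by
    intro T hT s hs
    have h1 : ∫ t in Ioc 0 T, ‖h t‖ ≤ s * D / 2 + T / (2 * s) := by
      have hd' : IntegrableOn d (Ioc 0 T) := hd.mono_set Ioc_subset_Ioi_self
      calc ∫ t in Ioc 0 T, ‖h t‖ ≤ ∫ t in Ioc 0 T, (s / 2 * d t + 1 / (2 * s)) := by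
            refine setIntegral_mono_on (hh.mono_set Ioc_subset_Ioi_self).norm
              ((hd'.const_mul _).add (integrableOn_const (by simp))) measurableSet_Ioc (fun t ht => ?_)
            have h3 := hle t ht.1
            have h4 : s / 2 * ‖h t‖ ^ 2 + 1 / (2 * s) - ‖h t‖ = (s * ‖h t‖ - 1) ^ 2 / (2 * s) := by
              field_simp
              ring
            have h5 : 0 ≤ (s * ‖h t‖ - 1) ^ 2 / (2 * s) := by positivity
            have h6 : s / 2 * ‖h t‖ ^ 2 ≤ s / 2 * d t := by gcongr
            linarith
        _ = s / 2 * (∫ t in Ioc 0 T, d t) + T / (2 * s) := by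
            rw [integral_add (hd'.const_mul _) (integrableOn_const (by simp)), integral_const_mul]
            simp [hT.le]
            field_simp
        _ ≤ s / 2 * D + T / (2 * s) := by
            gcongr
            exact setIntegral_mono_set hd (ae_restrict_of_forall_mem measurableSet_Ioi hd0)
              (Eventually.of_forall Ioc_subset_Ioi_self)
        _ = _ := by ring
    have h2 : ∫ t in Ioi T, ‖h t‖ ≤ 4 * L * T ^ (-(1 / 2) : ℝ) := by
      have hr : IntegrableOn (fun t : ℝ => t ^ (-(3 / 2) : ℝ)) (Ioi T) :=
        integrableOn_Ioi_rpow_of_lt (by norm_num) hT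
      calc ∫ t in Ioi T, ‖h t‖ ≤ ∫ t in Ioi T, 2 * L * t ^ (-(3 / 2) : ℝ) := by
            refine setIntegral_mono_on (hh.mono_set (Ioi_subset_Ioi hT.le)).norm
              (hr.const_mul _) measurableSet_Ioi (fun t ht => htail t (hT.trans ht))
        _ = _ := by
            rw [integral_const_mul, integral_Ioi_rpow_of_lt (by norm_num) hT]
            norm_num
            ring
    have h3 : ∫ t in Ioi 0, ‖h t‖ = (∫ t in Ioc 0 T, ‖h t‖) + ∫ t in Ioi T, ‖h t‖ := by
      rw [← setIntegral_union (Ioc_disjoint_Ioi le_rfl) measurableSet_Ioi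
        (hh.mono_set Ioc_subset_Ioi_self).norm (hh.mono_set (Ioi_subset_Ioi hT.le)).norm,
        Ioc_union_Ioi_eq_Ioi hT.le]
    have h4 : X ≤ ∫ t in Ioi 0, ‖h t‖ := norm_integral_le_integral_norm _
    linarith
  -- `T = r²` removes the half powers; in `s = r / u` the parameter `u` stands for an upper estimate
  -- of `√D`.
  have key2 : ∀ r > 0, ∀ u > 0, X ≤ D * r / (2 * u) + r * u / 2 + 4 * L / r := by
    intro r hr u hu
    have := key (r ^ 2) (by positivity) (r / u) (by positivity)
    have h1 : (r ^ 2) ^ (-(1 / 2) : ℝ) = r⁻¹ := by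
      rw [Real.rpow_neg (by positivity), ← Real.sqrt_eq_rpow, Real.sqrt_sq hr.le]
    rw [h1] at this
    refine this.trans (le_of_eq ?_)
    field_simp
  -- With `u = a` the bound is at most `a r + 4 l / r`, minimal at `r = 2 √(l / a)` with value `4
  -- √(l a)`. Strict upper estimates `a`, `l` keep the choice of `r` meaningful when `D` or `L`
  -- vanishes; the limits `l → L` and `a → √D` follow.
  have key3 : ∀ a > √D, ∀ l > L, X ^ 4 ≤ 256 * l ^ 2 * a ^ 2 := by
    intro a ha l hl
    have ha0 : 0 < a := (Real.sqrt_nonneg D).trans_lt ha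
    have hl0 : 0 < l := hL.trans_lt hl
    have hDa : D ≤ a ^ 2 := by
      rw [← Real.sqrt_le_left ha0.le]; exact ha.le
    set b := √a with hb
    set m := √l with hm
    have hbp : 0 < b := Real.sqrt_pos.2 ha0
    have hmp : 0 < m := Real.sqrt_pos.2 hl0
    have hb2 : a = b ^ 2 := (Real.sq_sqrt ha0.le).symm
    have hm2 : l = m ^ 2 := (Real.sq_sqrt hl0.le).symm
    have h1 := key2 (2 * m / b) (by positivity) a ha0
    have h2 : D * (2 * m / b) / (2 * a) + (2 * m / b) * a / 2 + 4 * L / (2 * m / b) ≤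
        a ^ 2 * (2 * m / b) / (2 * a) + (2 * m / b) * a / 2 + 4 * l / (2 * m / b) := by
      gcongr
    have h3 : a ^ 2 * (2 * m / b) / (2 * a) + (2 * m / b) * a / 2 + 4 * l / (2 * m / b) =
        4 * m * b := by
      rw [hb2, hm2]
      field_simp
      ring
    have h4 : X ≤ 4 * m * b := by linarith
    calc X ^ 4 ≤ (4 * m * b) ^ 4 := by
          gcongr
      _ = _ := by rw [hb2, hm2]; ring
  have key4 : ∀ a > √D, X ^ 4 ≤ 256 * L ^ 2 * a ^ 2 := by
    intro a ha
    have hc : Tendsto (fun l : ℝ => 256 * l ^ 2 * a ^ 2) (𝓝[>] L) (𝓝 (256 * L ^ 2 * a ^ 2)) :=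
      ((by fun_prop : Continuous fun l : ℝ => 256 * l ^ 2 * a ^ 2).tendsto L).mono_left
        nhdsWithin_le_nhds
    exact ge_of_tendsto hc (eventually_nhdsWithin_of_forall fun l hl => key3 a ha l hl)
  have hc : Tendsto (fun a : ℝ => 256 * L ^ 2 * a ^ 2) (𝓝[>] √D) (𝓝 (256 * L ^ 2 * √D ^ 2)) :=
    ((by fun_prop : Continuous fun a : ℝ => 256 * L ^ 2 * a ^ 2).tendsto _).mono_left
      nhdsWithin_le_nhds
  have := ge_of_tendsto hc (eventually_nhdsWithin_of_forall fun a ha => key4 a ha)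
  rwa [Real.sq_sqrt hD0] at this

/-- Quantitative comparison of a logarithmic gap with a square-root gap, given a resolvent gap
bound for every `t > 0`. -/
theorem pow_four_sqrt_gap_le_log_gap {E : Type*} [NormedAddCommGroup E] [NormedSpace ℝ E]
    [CompleteSpace E] {ι : Type*} [Fintype ι] (x c : ι → ℝ) (a : ι → E) {L : ℝ} (hL : 0 ≤ L)
    (hx : ∀ i, 0 ≤ x i) (hc0 : ∀ i, x i = 0 → c i = 0) (hc : ∑ i, c i = 0)
    (hres : ∀ t > 0, t * ‖∑ i, (t⁻¹ - (x i + t)⁻¹) • a i‖ ^ 2 ≤ ∑ i, c i * (x i + t)⁻¹)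
    (hbd : ∀ t > 0, ‖∑ i, (t⁻¹ - (x i + t)⁻¹) • a i‖ ≤ 2 * L / t ^ 2) :
    (Real.pi * ‖∑ i, √(x i) • a i‖) ^ 4 ≤ 256 * L ^ 2 * ∑ i, c i * -Real.log (x i) := by
  have hI1 : ∀ i, IntegrableOn (fun t => (√t * (t⁻¹ - (x i + t)⁻¹)) • a i) (Ioi 0) :=
    fun i => (integrableOn_sqrt_mul_inv_sub_inv (hx i)).smul_const _
  have hI2 : ∀ i, IntegrableOn (fun t => c i * ((x i + t)⁻¹ - (1 + t)⁻¹)) (Ioi 0) ∧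
      ∫ t in Ioi 0, c i * ((x i + t)⁻¹ - (1 + t)⁻¹) = c i * -Real.log (x i) := by
    intro i
    -- At `x i = 0` the integral itself diverges, but its weight `c i` vanishes.
    rcases (hx i).eq_or_lt with h | h
    · simp [hc0 i h.symm]
    · have := integral_inv_sub_inv_log h
      exact ⟨this.1.const_mul _, by rw [integral_const_mul, this.2]⟩
  have h1 := pow_four_integral_norm_le (h := fun t => ∑ i, (√t * (t⁻¹ - (x i + t)⁻¹)) • a i)
    (d := fun t => ∑ i, c i * ((x i + t)⁻¹ - (1 + t)⁻¹)) hL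
    (integrable_finsetSum _ fun i _ => hI1 i) (integrable_finsetSum _ fun i _ => (hI2 i).1)
    (fun t ht => by
      -- Squaring `√t` produces the factor `t` of the resolvent bound, and `∑ c i = 0` removes the
      -- comparison term `(1 + t)⁻¹`.
      have h2 := hres t ht
      simp_rw [mul_smul, ← Finset.smul_sum, norm_smul, mul_pow, mul_sub, Finset.sum_sub_distrib,
        ← Finset.sum_mul, hc, Real.norm_eq_abs, sq_abs, Real.sq_sqrt ht.le]
      simpa using h2)
    (fun t ht => by
      have h2 := hbd t ht
      simp_rw [mul_smul, ← Finset.smul_sum, norm_smul, Real.norm_eq_abs,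
        abs_of_nonneg (Real.sqrt_nonneg t)]
      calc √t * ‖∑ i, (t⁻¹ - (x i + t)⁻¹) • a i‖ ≤ √t * (2 * L / t ^ 2) := by gcongr
        _ = _ := by
          rw [Real.sqrt_eq_rpow, show (-(3 / 2) : ℝ) = 1 / 2 - 2 by norm_num,
            Real.rpow_sub ht, Real.rpow_two]
          ring)
  rw [integral_finsetSum _ fun i _ => hI1 i, integral_finsetSum _ fun i _ => (hI2 i).1] at h1
  simp_rw [fun i => (hI2 i).2, integral_smul_const, integral_sqrt_mul_inv_sub_inv (hx _),
    mul_smul, ← Finset.smul_sum, norm_smul, Real.norm_eq_abs, abs_of_pos Real.pi_pos] at h1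
  exact h1

end Integrals

/-! ### Functional calculus of Hermitian matrices -/

section FunctionalCalculus

variable {n m : Type*} [Fintype n] [DecidableEq n] [Fintype m] [DecidableEq m]

/-- The spectrum is finite, so the calculus is multiplicative and additive for all functions,
including the indicator of `0` and `Real.log` with its value `0` at `0`. -/
theorem continuousOn_spectrum (f : ℝ → ℝ) (A : Matrix n n ℂ) : ContinuousOn f (spectrum ℝ A) :=
  Matrix.finite_real_spectrum.continuousOn f

theorem isHermitian_cfc (f : ℝ → ℝ) (A : Matrix n n ℂ) : (cfc f A).IsHermitian :=
  cfc_predicate f A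

theorem conjTranspose_cfc (f : ℝ → ℝ) (A : Matrix n n ℂ) : (cfc f A)ᴴ = cfc f A :=
  isHermitian_cfc f A

theorem cfc_mul_cfc (f g : ℝ → ℝ) (A : Matrix n n ℂ) :
    cfc f A * cfc g A = cfc (fun x => f x * g x) A :=
  (cfc_mul f g A (continuousOn_spectrum f A) (continuousOn_spectrum g A)).symm

theorem spectrum_nonneg {A : Matrix n n ℂ} (hA : A.PosSemidef) {x : ℝ} (hx : x ∈ spectrum ℝ A) :
    0 ≤ x := by
  obtain ⟨i, rfl⟩ := hA.1.spectrum_real_eq_range_eigenvalues ▸ hx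
  exact hA.eigenvalues_nonneg i

theorem spectrum_le {A : Matrix n n ℂ} {L : ℝ}
    (hL : ((L : ℂ) • (1 : Matrix n n ℂ) - A).PosSemidef) {x : ℝ} (hx : x ∈ spectrum ℝ A) :
    x ≤ L := by
  have h : L - x ∈ spectrum ℝ ((L : ℂ) • (1 : Matrix n n ℂ) - A) := by
    have := (spectrum.add_mem_add_iff (R := ℝ) (a := -A) (r := -x) (s := L)).2 (by
      rwa [← spectrum.neg_eq, Set.neg_mem_neg])
    have h2 : algebraMap ℝ (Matrix n n ℂ) L + -A = (L : ℂ) • (1 : Matrix n n ℂ) - A := by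
      rw [Algebra.algebraMap_eq_smul_one, sub_eq_add_neg]
      rfl
    rw [← h2]
    convert this using 1
    ring
  linarith [spectrum_nonneg hL h]

theorem cfc_congr_nonneg {A : Matrix n n ℂ} (hA : A.PosSemidef) {f g : ℝ → ℝ}
    (h : ∀ x, 0 ≤ x → f x = g x) : cfc f A = cfc g A :=
  cfc_congr fun x hx => h x (spectrum_nonneg hA hx)

/-- A simultaneous polynomial representation of `cfc f` on two Hermitian matrices. -/
theorem exists_polynomial_cfc (f : ℝ → ℝ) {A : Matrix n n ℂ} {C : Matrix m m ℂ}
    (hA : A.IsHermitian) (hC : C.IsHermitian) :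
    ∃ p : Polynomial ℝ, cfc f A = Polynomial.aeval A p ∧ cfc f C = Polynomial.aeval C p := by
  classical
  have hfin : (spectrum ℝ A ∪ spectrum ℝ C).Finite :=
    Matrix.finite_real_spectrum.union Matrix.finite_real_spectrum
  set s := hfin.toFinset
  refine ⟨Lagrange.interpolate s id f, ?_, ?_⟩
  · rw [← cfc_polynomial _ A hA]
    refine cfc_congr fun x hx => ?_
    have := Lagrange.eval_interpolate_at_node (s := s) (v := id) (i := x) f
      Function.injective_id.injOn (by simp [s, hx])
    simpa using this.symm
  · rw [← cfc_polynomial _ C hC]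
    refine cfc_congr fun x hx => ?_
    have := Lagrange.eval_interpolate_at_node (s := s) (v := id) (i := x) f
      Function.injective_id.injOn (by simp [s, hx])
    simpa using this.symm

theorem aeval_mul_of_intertwine {A : Matrix n n ℂ} {C : Matrix m m ℂ} {B : Matrix n m ℂ}
    (h : A * B = B * C) (p : Polynomial ℝ) :
    Polynomial.aeval A p * B = B * Polynomial.aeval C p := by
  induction p using Polynomial.induction_on' with
  | add p q hp hq => simp [Matrix.add_mul, Matrix.mul_add, hp, hq]
  | monomial k r =>
    have : A ^ k * B = B * C ^ k := by
      induction k with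
      | zero => simp
      | succ k ih => rw [pow_succ, pow_succ', Matrix.mul_assoc, h, ← Matrix.mul_assoc, ih,
          Matrix.mul_assoc, ← pow_succ, ← pow_succ']
    simp [Polynomial.aeval_monomial, Algebra.algebraMap_eq_smul_one, this]

/-- The functional calculus respects intertwining relations. -/
theorem cfc_intertwine (f : ℝ → ℝ) {A : Matrix n n ℂ} {C : Matrix m m ℂ}
    (hA : A.IsHermitian) (hC : C.IsHermitian) {B : Matrix n m ℂ} (h : A * B = B * C) :
    cfc f A * B = B * cfc f C := by
  obtain ⟨p, h1, h2⟩ := exists_polynomial_cfc f hA hC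
  rw [h1, h2, aeval_mul_of_intertwine h]

theorem cfc_mul_of_mul_eq_smul (f : ℝ → ℝ) {A : Matrix n n ℂ} (hA : A.IsHermitian) {c : ℝ}
    {B : Matrix n m ℂ} (h : A * B = (c : ℂ) • B) : cfc f A * B = (f c : ℂ) • B := by
  have h2 : cfc f ((c : ℂ) • (1 : Matrix m m ℂ)) = (f c : ℂ) • (1 : Matrix m m ℂ) := by
    have := cfc_algebraMap (A := Matrix m m ℂ) c f
    rw [Algebra.algebraMap_eq_smul_one, Algebra.algebraMap_eq_smul_one] at this
    exact this
  rw [cfc_intertwine f hA (C := (c : ℂ) • 1) (B := B) _ (by simpa using h), h2]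
  · simp
  · simp [Matrix.IsHermitian]

theorem cfc_mul_of_mul_eq_zero (f : ℝ → ℝ) {A : Matrix n n ℂ} (hA : A.IsHermitian)
    {B : Matrix n m ℂ} (h : A * B = 0) : cfc f A * B = (f 0 : ℂ) • B :=
  cfc_mul_of_mul_eq_smul f hA (c := 0) (by simp [h])

/-- The spectral decomposition of a positive semidefinite matrix. -/
theorem exists_resolution {A : Matrix n n ℂ} (hA : A.IsHermitian) :
    ∃ (x : n → ℝ) (P : n → Matrix n n ℂ), (∀ i, x i ∈ spectrum ℝ A) ∧ (∀ i, (P i).PosSemidef) ∧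
      (∀ i, A * P i = (x i : ℂ) • P i) ∧ ∀ f : ℝ → ℝ, cfc f A = ∑ i, (f (x i) : ℂ) • P i := by
  set U : Matrix n n ℂ := (hA.eigenvectorUnitary : Matrix n n ℂ)
  have hU : star U * U = 1 := Unitary.coe_star_mul_self _
  have key : ∀ f : ℝ → ℝ, cfc f A = U * Matrix.diagonal (fun i => (f (hA.eigenvalues i) : ℂ)) * star U :=
    fun f => by
      rw [hA.cfc_eq, Matrix.IsHermitian.cfc, Unitary.conjStarAlgAut_apply]
      rfl
  refine ⟨hA.eigenvalues, fun i => U * Matrix.diagonal (Pi.single i 1) * star U,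
    hA.eigenvalues_mem_spectrum_real, fun i => ?_, fun i => ?_, fun f => ?_⟩
  · refine Matrix.PosSemidef.mul_mul_conjTranspose_same (Matrix.PosSemidef.diagonal ?_) U
    simp
  · have hid : A = U * Matrix.diagonal (fun i => (hA.eigenvalues i : ℂ)) * star U := by
      rw [← key fun x => x]
      exact (cfc_id' ℝ A hA).symm
    conv_lhs => rw [hid]
    have : U * Matrix.diagonal (fun i => (hA.eigenvalues i : ℂ)) * star U *
        (U * Matrix.diagonal (Pi.single i 1) * star U) =
        U * (Matrix.diagonal (fun i => (hA.eigenvalues i : ℂ)) * (star U * U) *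
          Matrix.diagonal (Pi.single i 1)) * star U := by
      simp only [Matrix.mul_assoc]
    rw [this, hU, Matrix.mul_one, Matrix.diagonal_mul_diagonal, ← Matrix.smul_mul,
      ← Matrix.mul_smul U, ← Matrix.diagonal_smul]
    congr 3
    ext j
    by_cases h : j = i
    · subst h
      simp
    · simp [h]
  · rw [key f]
    have h : ∀ i, (f (hA.eigenvalues i) : ℂ) • (U * Matrix.diagonal (Pi.single i 1) * star U) =
        U * Matrix.diagonal ((f (hA.eigenvalues i) : ℂ) • Pi.single i 1) * star U := fun i => by
      rw [Matrix.diagonal_smul, Matrix.mul_smul, Matrix.smul_mul]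
    simp_rw [h]
    rw [← Finset.sum_mul, ← Finset.mul_sum]
    congr 2
    ext i j
    rw [Matrix.sum_apply]
    by_cases h : i = j
    · subst h
      simp [Pi.single_apply]
    · simp [h]

/-- The orthogonal projection onto the support. -/
noncomputable def suppProj (A : Matrix n n ℂ) : Matrix n n ℂ :=
  cfc (fun x : ℝ => if x = 0 then 0 else 1) A

/-- The orthogonal projection onto the kernel. -/
noncomputable def kerProj (A : Matrix n n ℂ) : Matrix n n ℂ :=
  cfc (fun x : ℝ => if x = 0 then 1 else 0) A

theorem suppProj_add_kerProj {A : Matrix n n ℂ} (hA : A.IsHermitian) :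
    suppProj A + kerProj A = 1 := by
  rw [suppProj, kerProj, ← cfc_add _ _ _ (continuousOn_spectrum _ _) (continuousOn_spectrum _ _),
    ← cfc_one ℝ A hA]
  refine cfc_congr fun x _ => ?_
  by_cases h : x = 0 <;> simp [h]

theorem mul_kerProj {A : Matrix n n ℂ} (hA : A.IsHermitian) : A * kerProj A = 0 := by
  have h : cfc (fun x : ℝ => x) A = A := cfc_id' ℝ A hA
  have h2 := cfc_mul_cfc (fun x => x) (fun x : ℝ => if x = 0 then 1 else 0) A
  rw [h] at h2
  rw [kerProj, h2, ← cfc_zero ℝ A]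
  refine cfc_congr fun x _ => ?_
  by_cases h : x = 0 <;> simp [h]

theorem suppProj_mul_suppProj (A : Matrix n n ℂ) : suppProj A * suppProj A = suppProj A := by
  rw [suppProj, cfc_mul_cfc]
  refine cfc_congr fun x _ => ?_
  by_cases h : x = 0 <;> simp [h]

theorem kerProj_mul_kerProj (A : Matrix n n ℂ) : kerProj A * kerProj A = kerProj A := by
  rw [kerProj, cfc_mul_cfc]
  refine cfc_congr fun x _ => ?_
  by_cases h : x = 0 <;> simp [h]

theorem isHermitian_kerProj (A : Matrix n n ℂ) : (kerProj A).IsHermitian := isHermitian_cfc _ _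

theorem isHermitian_suppProj (A : Matrix n n ℂ) : (suppProj A).IsHermitian := isHermitian_cfc _ _

theorem mul_suppProj_of_mul_kerProj {ι : Type*} {A : Matrix n n ℂ} (hA : A.IsHermitian)
    {B : Matrix ι n ℂ}
    (h : B * kerProj A = 0) : B * suppProj A = B := by
  have := congrArg (B * ·) (suppProj_add_kerProj hA)
  simpa [Matrix.mul_add, h] using this

theorem conjTranspose_psdPow (A : Matrix n n ℂ) (s : ℝ) : (psdPow A s)ᴴ = psdPow A s :=
  isHermitian_cfc _ _

theorem posSemidef_cfc {A : Matrix n n ℂ} {f : ℝ → ℝ} (hf : ∀ x ∈ spectrum ℝ A, 0 ≤ f x) :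
    (cfc f A).PosSemidef := by
  have : cfc f A = (cfc (fun x => √(f x)) A)ᴴ * cfc (fun x => √(f x)) A := by
    rw [conjTranspose_cfc, cfc_mul_cfc]
    exact cfc_congr fun x hx => (Real.mul_self_sqrt (hf x hx)).symm
  rw [this]
  exact Matrix.posSemidef_conjTranspose_mul_self _

theorem psdPow_half_mul_psdPow_half {A : Matrix n n ℂ} (hA : A.PosSemidef) :
    psdPow A (1 / 2) * psdPow A (1 / 2) = A := by
  rw [psdPow, cfc_mul_cfc]
  conv_rhs => rw [← cfc_id' ℝ A hA.1]
  refine cfc_congr_nonneg hA fun x hx => ?_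
  rw [← Real.sqrt_eq_rpow, Real.mul_self_sqrt hx]

theorem psdPow_neg_half_mul_psdPow_half {A : Matrix n n ℂ} (hA : A.PosSemidef) :
    psdPow A (-1 / 2) * psdPow A (1 / 2) = suppProj A := by
  rw [psdPow, psdPow, cfc_mul_cfc]
  refine cfc_congr_nonneg hA fun x hx => ?_
  rcases hx.eq_or_lt with rfl | h
  · simp
  · rw [← Real.rpow_add h]
    norm_num [h.ne']

theorem psdPow_half_mul_psdPow_neg_half {A : Matrix n n ℂ} (hA : A.PosSemidef) :
    psdPow A (1 / 2) * psdPow A (-1 / 2) = suppProj A := by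
  rw [← psdPow_neg_half_mul_psdPow_half hA, psdPow, psdPow, cfc_mul_cfc, cfc_mul_cfc]
  simp_rw [mul_comm]

theorem psdPow_neg_half_mul_psdPow_neg_half {A : Matrix n n ℂ} (hA : A.PosSemidef) :
    psdPow A (-1 / 2) * psdPow A (-1 / 2) = mpInv A := by
  rw [psdPow, cfc_mul_cfc, mpInv]
  refine cfc_congr_nonneg hA fun x hx => ?_
  rcases hx.eq_or_lt with rfl | h
  · simp
  · rw [← Real.rpow_add h, ← Real.rpow_neg_one]
    norm_num

theorem suppProj_mul_cfc (A : Matrix n n ℂ) {f : ℝ → ℝ} (hf : f 0 = 0) :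
    suppProj A * cfc f A = cfc f A := by
  rw [suppProj, cfc_mul_cfc]
  refine cfc_congr fun x _ => ?_
  by_cases h : x = 0 <;> simp [h, hf]

theorem cfc_mul_suppProj (A : Matrix n n ℂ) {f : ℝ → ℝ} (hf : f 0 = 0) :
    cfc f A * suppProj A = cfc f A := by
  rw [suppProj, cfc_mul_cfc]
  refine cfc_congr fun x _ => ?_
  by_cases h : x = 0 <;> simp [h, hf]

theorem suppProj_mul_psdPow (A : Matrix n n ℂ) {s : ℝ} (hs : s ≠ 0) :
    suppProj A * psdPow A s = psdPow A s :=
  suppProj_mul_cfc A (Real.zero_rpow hs)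

theorem psdPow_mul_suppProj (A : Matrix n n ℂ) {s : ℝ} (hs : s ≠ 0) :
    psdPow A s * suppProj A = psdPow A s :=
  cfc_mul_suppProj A (Real.zero_rpow hs)

theorem mul_suppProj {A : Matrix n n ℂ} (hA : A.IsHermitian) : A * suppProj A = A :=
  mul_suppProj_of_mul_kerProj hA (mul_kerProj hA)

end FunctionalCalculus

/-! ### Order domination, supports and `Γ` -/

section Domination

variable {n m : Type*} [Fintype n] [DecidableEq n] [Fintype m]

theorem psdPow_half_mul_eq_zero_iff {A : Matrix n n ℂ} (hA : A.PosSemidef) {B : Matrix n m ℂ} :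
    psdPow A (1 / 2) * B = 0 ↔ A * B = 0 := by
  constructor
  · intro h
    rw [← psdPow_half_mul_psdPow_half hA, Matrix.mul_assoc, h, Matrix.mul_zero]
  · intro h
    rw [← Matrix.trace_conjTranspose_mul_self_eq_zero_iff, Matrix.conjTranspose_mul,
      conjTranspose_psdPow, Matrix.mul_assoc, ← Matrix.mul_assoc (psdPow A _),
      psdPow_half_mul_psdPow_half hA, h, Matrix.mul_zero, Matrix.trace_zero]

/-- If `ρ ≤ L σ`, then `ρ` vanishes where `σ` does. -/
theorem mul_eq_zero_of_le_smul {σ ρ : Matrix n n ℂ} {L : ℝ} (hρ : ρ.PosSemidef)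
    (h : ((L : ℂ) • σ - ρ).PosSemidef) {B : Matrix n m ℂ} (hB : σ * B = 0) : ρ * B = 0 := by
  rw [← psdPow_half_mul_eq_zero_iff hρ, ← Matrix.trace_conjTranspose_mul_self_eq_zero_iff]
  have h1 := (h.conjTranspose_mul_mul_same B).trace_nonneg
  have h2 : (psdPow ρ (1 / 2) * B)ᴴ * (psdPow ρ (1 / 2) * B) = Bᴴ * ρ * B := by
    rw [Matrix.conjTranspose_mul, conjTranspose_psdPow, Matrix.mul_assoc,
      ← Matrix.mul_assoc (psdPow ρ _), psdPow_half_mul_psdPow_half hρ, Matrix.mul_assoc]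
  have h3 := (Matrix.posSemidef_conjTranspose_mul_self (psdPow ρ (1 / 2) * B)).trace_nonneg
  rw [Matrix.mul_assoc, Matrix.sub_mul, Matrix.smul_mul, hB, smul_zero, zero_sub, Matrix.mul_neg,
    Matrix.trace_neg, ← Matrix.mul_assoc, ← h2] at h1
  exact le_antisymm (neg_nonneg.1 h1) h3

theorem posSemidef_gam {σ ρ : Matrix n n ℂ} (hρ : ρ.PosSemidef) : (gam σ ρ).PosSemidef := by
  have := hρ.mul_mul_conjTranspose_same (psdPow σ (-1 / 2))
  rwa [conjTranspose_psdPow] at this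

/-- Conjugating by `σ^{-1/2}` and back compresses `ρ` to the support of `σ`, which loses nothing
when `ρ` vanishes on the kernel of `σ`. -/
theorem psdPow_half_mul_gam_mul_psdPow_half {σ ρ : Matrix n n ℂ} (hσ : σ.PosSemidef)
    (hρ : ρ.PosSemidef) (h : ρ * kerProj σ = 0) :
    psdPow σ (1 / 2) * gam σ ρ * psdPow σ (1 / 2) = ρ := by
  have h1 : ρ * suppProj σ = ρ := mul_suppProj_of_mul_kerProj hσ.1 h
  have h2 : suppProj σ * ρ = ρ := by
    have := congrArg Matrix.conjTranspose h1
    rwa [Matrix.conjTranspose_mul, (isHermitian_suppProj σ).eq, hρ.1.eq] at this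
  calc psdPow σ (1 / 2) * gam σ ρ * psdPow σ (1 / 2)
      = (psdPow σ (1 / 2) * psdPow σ (-1 / 2)) * ρ *
          (psdPow σ (-1 / 2) * psdPow σ (1 / 2)) := by simp only [gam, Matrix.mul_assoc]
    _ = ρ := by
      rw [psdPow_neg_half_mul_psdPow_half hσ, psdPow_half_mul_psdPow_neg_half hσ, h2, h1]

theorem suppProj_mul_gam (σ ρ : Matrix n n ℂ) : suppProj σ * gam σ ρ = gam σ ρ := by
  rw [gam, ← Matrix.mul_assoc, ← Matrix.mul_assoc, suppProj_mul_psdPow _ (by norm_num)]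

theorem gam_mul_suppProj (σ ρ : Matrix n n ℂ) : gam σ ρ * suppProj σ = gam σ ρ := by
  rw [gam, Matrix.mul_assoc, psdPow_mul_suppProj _ (by norm_num)]

theorem cfc_gam_mul_suppProj {σ ρ : Matrix n n ℂ} (hρ : ρ.PosSemidef) (f : ℝ → ℝ) :
    cfc f (gam σ ρ) * suppProj σ = suppProj σ * cfc f (gam σ ρ) :=
  cfc_intertwine f (posSemidef_gam hρ).1 (posSemidef_gam hρ).1
    (by rw [suppProj_mul_gam, gam_mul_suppProj])

theorem le_smul_of_gam_le {σ ρ : Matrix n n ℂ} {L : ℝ} (hσ : σ.PosSemidef)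
    (hρ : ρ.PosSemidef) (h : ρ * kerProj σ = 0)
    (hL : ((L : ℂ) • (1 : Matrix n n ℂ) - gam σ ρ).PosSemidef) :
    ((L : ℂ) • σ - ρ).PosSemidef := by
  have := hL.mul_mul_conjTranspose_same (psdPow σ (1 / 2))
  rwa [conjTranspose_psdPow, Matrix.mul_sub, Matrix.sub_mul,
    psdPow_half_mul_gam_mul_psdPow_half hσ hρ h, Matrix.mul_smul, Matrix.smul_mul, Matrix.mul_one,
    psdPow_half_mul_psdPow_half hσ] at this

theorem posSemidef_ofReal_smul {ι : Type*} {A : Matrix ι ι ℂ} (hA : A.PosSemidef) {c : ℝ}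
    (hc : 0 ≤ c) :
    ((c : ℂ) • A).PosSemidef :=
  hA.smul (by exact_mod_cast hc)

theorem posSemidef_kerProj (A : Matrix n n ℂ) : (kerProj A).PosSemidef :=
  posSemidef_cfc fun x _ => by split_ifs <;> norm_num

/-- Conjugating the hypothesis by `σ^{-1/2}` gives a bound by `L` times the support projection;
adding `L` times the kernel projection completes it to `L • 1`. -/
theorem gam_le_of_le_smul {σ ρ : Matrix n n ℂ} {L : ℝ} (hL : 0 ≤ L) (hσ : σ.PosSemidef)
    (h : ((L : ℂ) • σ - ρ).PosSemidef) :
    ((L : ℂ) • (1 : Matrix n n ℂ) - gam σ ρ).PosSemidef := by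
  have h1 := (h.mul_mul_conjTranspose_same (psdPow σ (-1 / 2))).add
    (posSemidef_ofReal_smul (posSemidef_kerProj σ) hL)
  have h2 : psdPow σ (-1 / 2) * σ * psdPow σ (-1 / 2) = suppProj σ := by
    calc psdPow σ (-1 / 2) * σ * psdPow σ (-1 / 2)
        = psdPow σ (-1 / 2) * (psdPow σ (1 / 2) * psdPow σ (1 / 2)) * psdPow σ (-1 / 2) := by
          rw [psdPow_half_mul_psdPow_half hσ]
      _ = (psdPow σ (-1 / 2) * psdPow σ (1 / 2)) * (psdPow σ (1 / 2) * psdPow σ (-1 / 2)) := by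
          simp only [Matrix.mul_assoc]
      _ = suppProj σ := by
          rw [psdPow_neg_half_mul_psdPow_half hσ, psdPow_half_mul_psdPow_neg_half hσ,
            suppProj_mul_suppProj]
  rw [conjTranspose_psdPow, Matrix.mul_sub, Matrix.sub_mul, Matrix.mul_smul, Matrix.smul_mul, h2,
    ← gam] at h1
  rw [← suppProj_add_kerProj hσ.1, smul_add]
  convert h1 using 1
  abel

/-- From `Γ B = 0` it follows that `ρ` kills `σ^{-1/2} B`; then so does `σ`, by domination, and `B`
has no component in the support of `σ`. Hence the eigenvalue `0` of `Γ` carries no weight of `σ`,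
and the value of `log` there is irrelevant. -/
theorem mul_eq_zero_of_gam_mul_eq_zero {σ ρ : Matrix n n ℂ} {c : ℝ} (hσ : σ.PosSemidef)
    (hρ : ρ.PosSemidef) (hρσ : ρ * kerProj σ = 0) (h : ((c : ℂ) • ρ - σ).PosSemidef)
    {B : Matrix n m ℂ} (hB : gam σ ρ * B = 0) : σ * B = 0 := by
  have h1 : ρ * (psdPow σ (-1 / 2) * B) = 0 := by
    have h3 : suppProj σ * ρ = ρ := by
      have := congrArg Matrix.conjTranspose (mul_suppProj_of_mul_kerProj hσ.1 hρσ)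
      rwa [Matrix.conjTranspose_mul, (isHermitian_suppProj σ).eq, hρ.1.eq] at this
    have h2 := congrArg (psdPow σ (1 / 2) * ·) hB
    simp only [gam, Matrix.mul_zero, ← Matrix.mul_assoc,
      psdPow_half_mul_psdPow_neg_half hσ, h3] at h2
    rw [← Matrix.mul_assoc, h2]
  have h4 := mul_eq_zero_of_le_smul hσ h h1
  rw [← psdPow_half_mul_eq_zero_iff hσ, ← Matrix.mul_assoc,
    psdPow_half_mul_psdPow_neg_half hσ] at h4
  rw [← mul_suppProj hσ.1, Matrix.mul_assoc, h4, Matrix.mul_zero]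

theorem smul_one_sub_eq_cfc {A : Matrix n n ℂ} (hA : A.IsHermitian) (c : ℝ) :
    (c : ℂ) • (1 : Matrix n n ℂ) - A = cfc (fun x => c - x) A := by
  rw [cfc_sub _ _ _ (continuousOn_spectrum _ _) (continuousOn_spectrum _ _),
    cfc_const c A hA.isSelfAdjoint, cfc_id' ℝ A hA.isSelfAdjoint, Algebra.algebraMap_eq_smul_one]
  rfl

open scoped Matrix.Norms.L2Operator in
theorem spectrum_le_opNorm {A : Matrix n n ℂ} {x : ℝ} (hx : x ∈ spectrum ℝ A) : x ≤ opNorm A := by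
  have h1 : ‖x‖ ≤ ‖A‖ * ‖(1 : Matrix n n ℂ)‖ := spectrum.norm_le_norm_mul_of_mem hx
  -- Only an inequality, because the index type may be empty.
  have h2 : ‖(1 : Matrix n n ℂ)‖ ≤ 1 := by
    have h3 : ‖(1 : Matrix n n ℂ)‖ = ‖Matrix.toEuclideanCLM (n := n) (𝕜 := ℂ) 1‖ := rfl
    rw [h3, map_one]
    exact ContinuousLinearMap.norm_id_le
  have h3 : opNorm A = ‖A‖ := rfl
  rw [h3]
  calc x ≤ ‖x‖ := le_abs_self x
    _ ≤ ‖A‖ * ‖(1 : Matrix n n ℂ)‖ := h1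
    _ ≤ ‖A‖ * 1 := by gcongr
    _ = _ := mul_one _

theorem posSemidef_opNorm_smul_one_sub {A : Matrix n n ℂ} (hA : A.IsHermitian) :
    ((opNorm A : ℂ) • (1 : Matrix n n ℂ) - A).PosSemidef := by
  rw [smul_one_sub_eq_cfc hA]
  exact posSemidef_cfc fun x hx => sub_nonneg.2 (spectrum_le_opNorm hx)

theorem opNorm_nonneg (A : Matrix n n ℂ) : 0 ≤ opNorm A := norm_nonneg _

/-- Inclusion of supports, as domination by a multiple. -/
theorem posSemidef_opNorm_gam_smul_sub {σ ρ : Matrix n n ℂ} (hσ : σ.PosSemidef)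
    (hρ : ρ.PosSemidef) (h : ρ * kerProj σ = 0) :
    ((opNorm (gam σ ρ) : ℂ) • σ - ρ).PosSemidef :=
  le_smul_of_gam_le hσ hρ h (posSemidef_opNorm_smul_one_sub (posSemidef_gam hρ).1)

/-- The columns of the kernel projection of `σ` lie in `ker σ`. This matrix equation is the form in
which support inclusion is used throughout. -/
theorem mul_kerProj_of_support_le {σ ρ : Matrix n n ℂ} (hσ : σ.PosSemidef)
    (h : support ρ ≤ support σ) : ρ * kerProj σ = 0 := by
  rw [support, support, Submodule.orthogonal_le_orthogonal_iff] at h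
  ext i j
  set x : n → ℂ := fun l => kerProj σ l j
  have hx : Matrix.toEuclideanLin σ (WithLp.toLp 2 x) = 0 := by
    rw [Matrix.toLpLin_apply]
    ext l
    exact congrFun (congrFun (mul_kerProj hσ.1) l) j
  have hy : Matrix.toEuclideanLin ρ (WithLp.toLp 2 x) = 0 := h hx
  rw [Matrix.toLpLin_apply] at hy
  exact congrFun (congrArg WithLp.ofLp hy) i

theorem cfc_resolvent_mul_add {A : Matrix n n ℂ} (hA : A.PosSemidef) {t : ℝ} (ht : 0 < t) :
    cfc (fun x => (x + t)⁻¹) A * (A + (t : ℂ) • 1) = 1 := by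
  have h1 : A + (t : ℂ) • 1 = cfc (fun x => x + t) A := by
    rw [cfc_add _ _ _ (continuousOn_spectrum _ _) (continuousOn_spectrum _ _),
      cfc_const t A hA.1.isSelfAdjoint, cfc_id' ℝ A hA.1.isSelfAdjoint,
      Algebra.algebraMap_eq_smul_one]
    rfl
  rw [h1, cfc_mul_cfc, ← cfc_one ℝ A hA.1.isSelfAdjoint]
  refine cfc_congr_nonneg hA fun x hx => ?_
  have : x + t ≠ 0 := by positivity
  simp [this]

end Domination

/-! ### Partial trace -/

section PartialTrace

variable {k v l : Type*} [Fintype v]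

theorem partialTrace_add (X Y : Matrix (k × v) (k × v) ℂ) :
    partialTrace (X + Y) = partialTrace X + partialTrace Y := by
  ext i j
  simp [partialTrace, Finset.sum_add_distrib]

theorem partialTrace_smul (c : ℂ) (X : Matrix (k × v) (k × v) ℂ) :
    partialTrace (c • X) = c • partialTrace X := by
  ext i j
  simp [partialTrace, Finset.mul_sum]

theorem partialTrace_sub (X Y : Matrix (k × v) (k × v) ℂ) :
    partialTrace (X - Y) = partialTrace X - partialTrace Y := by
  ext i j
  simp [partialTrace, Finset.sum_sub_distrib]

theorem trace_partialTrace [Fintype k] (X : Matrix (k × v) (k × v) ℂ) :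
    (partialTrace X).trace = X.trace := by
  simp [partialTrace, Matrix.trace, Fintype.sum_prod_type]

/-- The partial trace is a bimodule map for the operators on the first factor. Together with
`trace_partialTrace` this moves traces on the dilation space down to `k`. -/
theorem partialTrace_kronecker_mul [Fintype k] [DecidableEq v] (A : Matrix k k ℂ)
    (X : Matrix (k × v) (k × v) ℂ) :
    partialTrace ((A ⊗ₖ (1 : Matrix v v ℂ)) * X) = A * partialTrace X := by
  ext i j
  simp only [partialTrace, Matrix.of_apply, Matrix.mul_apply, Fintype.sum_prod_type,
    Matrix.kroneckerMap_apply, Matrix.one_apply, mul_ite, mul_one, mul_zero, ite_mul, zero_mul,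
    Finset.sum_ite_eq, Finset.mem_univ, if_true, Finset.mul_sum]
  exact Finset.sum_comm

theorem partialTrace_mul_kronecker [Fintype k] [DecidableEq v] (A : Matrix k k ℂ)
    (X : Matrix (k × v) (k × v) ℂ) :
    partialTrace (X * (A ⊗ₖ (1 : Matrix v v ℂ))) = partialTrace X * A := by
  ext i j
  simp only [partialTrace, Matrix.of_apply, Matrix.mul_apply, Fintype.sum_prod_type,
    Matrix.kroneckerMap_apply, Matrix.one_apply, mul_ite, mul_one, mul_zero,
    Finset.sum_ite_eq', Finset.mem_univ, if_true, Finset.sum_mul]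
  exact Finset.sum_comm

theorem posSemidef_partialTrace {X : Matrix (k × v) (k × v) ℂ} (hX : X.PosSemidef) :
    (partialTrace X).PosSemidef := by
  have : partialTrace X = ∑ a : v, X.submatrix (fun i => (i, a)) (fun i => (i, a)) := by
    ext i j
    simp [partialTrace, Matrix.sum_apply]
  rw [this]
  exact Matrix.posSemidef_sum _ fun a _ => hX.submatrix _

end PartialTrace

/-! ### Hilbert-Schmidt norm -/

section HilbertSchmidt

variable {p q r : Type*} [Fintype p] [Fintype q] [Fintype r]

/-- A matrix as a vector of the Hilbert space of Hilbert-Schmidt operators. -/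
def vec : Matrix p q ℂ →ₗ[ℂ] EuclideanSpace ℂ (p × q) where
  toFun A := WithLp.toLp 2 fun x => A x.1 x.2
  map_add' _ _ := rfl
  map_smul' _ _ := rfl

theorem vec_apply (A : Matrix p q ℂ) (x : p × q) : vec A x = A x.1 x.2 := rfl

theorem inner_vec (A B : Matrix p q ℂ) : inner ℂ (vec A) (vec B) = (Aᴴ * B).trace := by
  simp only [vec_apply, PiLp.inner_apply, Fintype.sum_prod_type,
    Matrix.trace, Matrix.diag, Matrix.mul_apply, Matrix.conjTranspose_apply, RCLike.inner_apply]
  rw [Finset.sum_comm]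
  simp [mul_comm]

theorem norm_vec_sq (A : Matrix p q ℂ) : ‖vec A‖ ^ 2 = (Aᴴ * A).trace.re := by
  rw [← inner_vec, ← inner_self_eq_norm_sq (𝕜 := ℂ)]
  rfl

theorem norm_vec_sq' (A : Matrix p q ℂ) : ‖vec A‖ ^ 2 = (A * Aᴴ).trace.re := by
  rw [norm_vec_sq, Matrix.trace_mul_comm]

theorem hsNorm_eq_norm_vec (A : Matrix p p ℂ) : hsNorm A = ‖vec A‖ := by
  rw [hsNorm, ← norm_vec_sq, Real.sqrt_sq (norm_nonneg _)]

theorem norm_vec_conjTranspose (A : Matrix p q ℂ) : ‖vec Aᴴ‖ = ‖vec A‖ := by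
  rw [← sq_eq_sq₀ (norm_nonneg _) (norm_nonneg _), norm_vec_sq, norm_vec_sq',
    Matrix.conjTranspose_conjTranspose]

theorem norm_vec_isometry_mul [DecidableEq q] {V : Matrix p q ℂ} (hV : Vᴴ * V = 1)
    (A : Matrix q r ℂ) : ‖vec (V * A)‖ = ‖vec A‖ := by
  rw [← sq_eq_sq₀ (norm_nonneg _) (norm_nonneg _), norm_vec_sq, norm_vec_sq,
    Matrix.conjTranspose_mul, Matrix.mul_assoc, ← Matrix.mul_assoc Vᴴ, hV, Matrix.one_mul]

theorem re_trace_nonneg {A : Matrix p p ℂ} (hA : A.PosSemidef) : 0 ≤ A.trace.re :=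
  (Complex.le_def.1 hA.trace_nonneg).1

/-- Right multiplication by `B` is bounded by `c` in Hilbert-Schmidt norm if `B B* ≤ c²`. -/
theorem norm_vec_mul_le [DecidableEq q] (A : Matrix p q ℂ) {B : Matrix q r ℂ} {c : ℝ} (hc : 0 ≤ c)
    (h : (((c ^ 2 : ℝ) : ℂ) • (1 : Matrix q q ℂ) - B * Bᴴ).PosSemidef) :
    ‖vec (A * B)‖ ≤ c * ‖vec A‖ := by
  rw [← sq_le_sq₀ (norm_nonneg _) (by positivity), mul_pow, norm_vec_sq', norm_vec_sq']
  have h1 := re_trace_nonneg (h.mul_mul_conjTranspose_same A)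
  rw [Matrix.mul_sub, Matrix.sub_mul, Matrix.mul_smul, Matrix.mul_one, Matrix.smul_mul,
    Matrix.trace_sub, Matrix.trace_smul, Complex.sub_re, smul_eq_mul, Complex.re_ofReal_mul] at h1
  rw [Matrix.conjTranspose_mul, Matrix.mul_assoc, ← Matrix.mul_assoc B, ← Matrix.mul_assoc]
  linarith

theorem norm_vec_mul_le' [DecidableEq q] {B : Matrix r q ℂ} (A : Matrix q p ℂ) {c : ℝ} (hc : 0 ≤ c)
    (h : (((c ^ 2 : ℝ) : ℂ) • (1 : Matrix q q ℂ) - Bᴴ * B).PosSemidef) :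
    ‖vec (B * A)‖ ≤ c * ‖vec A‖ := by
  rw [← norm_vec_conjTranspose, ← norm_vec_conjTranspose A, Matrix.conjTranspose_mul]
  exact norm_vec_mul_le _ hc (by rwa [Matrix.conjTranspose_conjTranspose])

end HilbertSchmidt

/-! ### The gap operator and its resolvent estimate -/

section Core

variable {n k v : Type*} [Fintype n] [DecidableEq n] [Fintype k] [DecidableEq k] [Fintype v]
  [DecidableEq v]

theorem kronecker_one_mul (A B : Matrix k k ℂ) :
    (A * B) ⊗ₖ (1 : Matrix v v ℂ) = (A ⊗ₖ (1 : Matrix v v ℂ)) * (B ⊗ₖ (1 : Matrix v v ℂ)) := by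
  rw [← Matrix.mul_kronecker_mul, Matrix.one_mul]

theorem conjTranspose_kronecker_one (A : Matrix k k ℂ) :
    (A ⊗ₖ (1 : Matrix v v ℂ))ᴴ = Aᴴ ⊗ₖ (1 : Matrix v v ℂ) := by
  rw [Matrix.conjTranspose_kronecker, Matrix.conjTranspose_one]

/-- The kernel part `(Q ⊗ 1) U` has squared Hilbert-Schmidt norm `tr[Q τ Q] = 0`, where `Q` is the
kernel projection of `τ`. -/
theorem suppProj_kronecker_mul {U : Matrix (k × v) n ℂ} {τ : Matrix k k ℂ} (hτ : τ.IsHermitian)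
    (hU : partialTrace (U * Uᴴ) = τ) : (suppProj τ ⊗ₖ (1 : Matrix v v ℂ)) * U = U := by
  have h : (kerProj τ ⊗ₖ (1 : Matrix v v ℂ)) * U = 0 := by
    rw [← Matrix.trace_mul_conjTranspose_self_eq_zero_iff, Matrix.conjTranspose_mul,
      conjTranspose_kronecker_one, (isHermitian_kerProj τ).eq, Matrix.mul_assoc,
      ← Matrix.mul_assoc U, ← Matrix.mul_assoc, ← trace_partialTrace, partialTrace_mul_kronecker,
      partialTrace_kronecker_mul, hU, Matrix.mul_assoc, mul_kerProj hτ, Matrix.mul_zero,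
      Matrix.trace_zero]
  have h2 := congrArg (fun A => (A ⊗ₖ (1 : Matrix v v ℂ)) * U) (suppProj_add_kerProj hτ)
  simpa [Matrix.add_kronecker, Matrix.add_mul, h] using h2

/-- The difference of the functional calculi of `Γ` and of its compression `gam τ θ`, applied to
`U` and to `τ^{1/2}` respectively. -/
noncomputable def funcGap (U : Matrix (k × v) n ℂ) (Γ : Matrix n n ℂ) (τ θ : Matrix k k ℂ) (f : ℝ → ℝ) :
    Matrix (k × v) n ℂ :=
  U * cfc f Γ -
    ((psdPow τ (1 / 2) * cfc f (gam τ θ) * psdPow τ (-1 / 2)) ⊗ₖ (1 : Matrix v v ℂ)) * U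

theorem norm_vec_mul_cfc_sq (U : Matrix (k × v) n ℂ) (Γ : Matrix n n ℂ) (f : ℝ → ℝ) :
    ‖vec (U * cfc f Γ)‖ ^ 2 = (U * cfc (fun x => f x * f x) Γ * Uᴴ).trace.re := by
  rw [norm_vec_sq', Matrix.conjTranspose_mul, conjTranspose_cfc, ← cfc_mul_cfc]
  simp only [Matrix.mul_assoc]

/-- The partial trace replaces `U U*` by `τ`; the inner factor `τ^{-1/2} τ τ^{-1/2}` is the support
projection, which commutes with functions of `gam τ θ` and is absorbed by `τ^{1/2}`. -/
theorem norm_vec_kronecker_cfc_sq {U : Matrix (k × v) n ℂ} {τ θ : Matrix k k ℂ}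
    (hτ : τ.PosSemidef) (hθ : θ.PosSemidef) (hU : partialTrace (U * Uᴴ) = τ) (f : ℝ → ℝ) :
    ‖vec (((psdPow τ (1 / 2) * cfc f (gam τ θ) * psdPow τ (-1 / 2)) ⊗ₖ (1 : Matrix v v ℂ)) * U)‖ ^ 2
      = (τ * cfc (fun x => f x * f x) (gam τ θ)).trace.re := by
  set s := psdPow τ (1 / 2) with hs
  set r := psdPow τ (-1 / 2) with hr
  set H := cfc f (gam τ θ) with hH
  have hsr : s * r = suppProj τ := psdPow_half_mul_psdPow_neg_half hτ
  have hrs : r * s = suppProj τ := psdPow_neg_half_mul_psdPow_half hτ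
  have hss : s * s = τ := psdPow_half_mul_psdPow_half hτ
  have hPH : suppProj τ * H = H * suppProj τ := (cfc_gam_mul_suppProj hθ f).symm
  have hPs : suppProj τ * s = s := suppProj_mul_psdPow _ (by norm_num)
  have hPP := suppProj_mul_suppProj τ
  have h1 : r * τ * r = suppProj τ := by
    calc r * τ * r = r * (s * s) * r := by rw [hss]
      _ = (r * s) * (s * r) := by simp only [Matrix.mul_assoc]
      _ = suppProj τ := by rw [hrs, hsr, hPP]
  rw [norm_vec_sq', Matrix.conjTranspose_mul, conjTranspose_kronecker_one, Matrix.mul_assoc,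
    ← Matrix.mul_assoc U, ← Matrix.mul_assoc, ← trace_partialTrace, partialTrace_mul_kronecker,
    partialTrace_kronecker_mul, hU, Matrix.conjTranspose_mul, Matrix.conjTranspose_mul,
    hH, conjTranspose_cfc, ← hH, hs, hr, conjTranspose_psdPow, conjTranspose_psdPow, ← hs, ← hr,
    ← cfc_mul_cfc, ← hH]
  have h2 : s * H * r * τ * (r * (H * s)) = s * (H * H) * s := by
    calc s * H * r * τ * (r * (H * s)) = s * H * (r * τ * r) * H * s := by
          simp only [Matrix.mul_assoc]
      _ = s * H * (suppProj τ * H) * s := by rw [h1]; simp only [Matrix.mul_assoc]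
      _ = s * (H * H) * (suppProj τ * s) := by rw [hPH]; simp only [Matrix.mul_assoc]
      _ = _ := by rw [hPs]
  rw [h2, Matrix.trace_mul_comm, ← Matrix.mul_assoc, hss]

/-- Put `A = Γ + t`, `B = Γ_T + t`, with inverses `G`, `H`. In `tr[W A W*]` the cross terms simplify
because `G A = 1`, and the quadratic term because `U A U*` has partial trace `τ^{1/2} B τ^{1/2}`.
Each of these three terms equals `± tr[τ H]`, so the trace is exactly the right-hand side; then `A ≥
t` gives the inequality. -/
theorem funcGap_resolvent {U : Matrix (k × v) n ℂ} {Γ : Matrix n n ℂ} {τ θ : Matrix k k ℂ}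
    (hΓ : Γ.PosSemidef) (hτ : τ.PosSemidef) (hθ : θ.PosSemidef) (hU : partialTrace (U * Uᴴ) = τ)
    (hUΓ : partialTrace (U * Γ * Uᴴ) = θ) (hθτ : θ * kerProj τ = 0) {t : ℝ} (ht : 0 < t) :
    t * ‖vec (funcGap U Γ τ θ fun x => (x + t)⁻¹)‖ ^ 2 ≤
      (U * cfc (fun x => (x + t)⁻¹) Γ * Uᴴ).trace.re -
        (τ * cfc (fun x => (x + t)⁻¹) (gam τ θ)).trace.re := by
  set s := psdPow τ (1 / 2) with hs
  set r := psdPow τ (-1 / 2) with hr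
  set H := cfc (fun x => (x + t)⁻¹) (gam τ θ) with hH
  set G := cfc (fun x => (x + t)⁻¹) Γ with hG
  set P := suppProj τ with hP
  have hGT := posSemidef_gam (σ := τ) hθ
  have hGA : G * (Γ + (t : ℂ) • 1) = 1 := cfc_resolvent_mul_add hΓ ht
  have hAG : (Γ + (t : ℂ) • 1) * G = 1 := by rwa [mul_eq_one_comm]
  have hHB : H * (gam τ θ + (t : ℂ) • 1) = 1 := cfc_resolvent_mul_add hGT ht
  set A := Γ + (t : ℂ) • 1 with hA
  set B := gam τ θ + (t : ℂ) • 1 with hB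
  have hsr : s * r = P := psdPow_half_mul_psdPow_neg_half hτ
  have hrs : r * s = P := psdPow_neg_half_mul_psdPow_half hτ
  have hss : s * s = τ := psdPow_half_mul_psdPow_half hτ
  have hPH : P * H = H * P := (cfc_gam_mul_suppProj hθ _).symm
  have hPs : P * s = s := suppProj_mul_psdPow _ (by norm_num)
  have hsP : s * P = s := psdPow_mul_suppProj _ (by norm_num)
  have hH' : Hᴴ = H := conjTranspose_cfc _ _
  have hG' : Gᴴ = G := conjTranspose_cfc _ _
  have hs' : sᴴ = s := conjTranspose_psdPow _ _
  have hr' : rᴴ = r := conjTranspose_psdPow _ _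
  have hsBs : s * B * s = θ + (t : ℂ) • τ := by
    rw [hB, Matrix.mul_add, Matrix.add_mul, psdPow_half_mul_gam_mul_psdPow_half hτ hθ hθτ]
    simp [hss]
  have hUA : partialTrace (U * A * Uᴴ) = s * B * s := by
    rw [hsBs, hA, Matrix.mul_add, Matrix.add_mul, partialTrace_add, hUΓ, Matrix.mul_smul,
      Matrix.mul_one, Matrix.smul_mul, partialTrace_smul, hU]
  set b := s * H * r with hb
  have hb' : bᴴ = r * H * s := by
    rw [hb, Matrix.conjTranspose_mul, Matrix.conjTranspose_mul, hs', hr', hH', Matrix.mul_assoc]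
  set K := b ⊗ₖ (1 : Matrix v v ℂ) with hK
  have hK' : Kᴴ = bᴴ ⊗ₖ (1 : Matrix v v ℂ) := conjTranspose_kronecker_one b
  have e1 : b * τ = s * H * s := by
    calc b * τ = s * H * ((r * s) * s) := by rw [hb, ← hss]; simp only [Matrix.mul_assoc]
      _ = _ := by rw [hrs, hPs]
  have e2 : τ * bᴴ = s * H * s := by
    calc τ * bᴴ = (s * (s * r)) * (H * s) := by rw [hb', ← hss]; simp only [Matrix.mul_assoc]
      _ = _ := by rw [hsr, hsP, Matrix.mul_assoc]
  have e3 : b * (s * B * s) * bᴴ = s * H * s := by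
    calc b * (s * B * s) * bᴴ = s * H * (r * s) * B * ((s * r) * H) * s := by
          rw [hb, hb']; simp only [Matrix.mul_assoc]
      _ = s * (P * H) * B * (H * P) * s := by
          rw [hrs, hsr, hPH]; simp only [Matrix.mul_assoc]
      _ = (s * P) * (H * B) * H * (P * s) := by simp only [Matrix.mul_assoc]
      _ = _ := by rw [hsP, hHB, hPs, Matrix.mul_one]
  set W := U * G - K * U with hW
  have hWA : W * A * Wᴴ = U * G * Uᴴ - (U * Uᴴ) * Kᴴ - K * (U * Uᴴ) + K * (U * A * Uᴴ) * Kᴴ := by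
    have h1 : W * A = U - K * U * A := by
      rw [hW, Matrix.sub_mul, Matrix.mul_assoc U, hGA, Matrix.mul_one]
    have h2 : K * U * A * (G * Uᴴ) = K * (U * Uᴴ) := by
      calc K * U * A * (G * Uᴴ) = K * U * (A * G) * Uᴴ := by simp only [Matrix.mul_assoc]
        _ = _ := by rw [hAG, Matrix.mul_one, Matrix.mul_assoc]
    rw [h1, hW, Matrix.conjTranspose_sub, Matrix.conjTranspose_mul, Matrix.conjTranspose_mul, hG',
      Matrix.sub_mul, Matrix.mul_sub, Matrix.mul_sub, h2]
    simp only [Matrix.mul_assoc]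
    abel
  have htr : (W * A * Wᴴ).trace = (U * G * Uᴴ).trace - (τ * H).trace := by
    rw [hWA, Matrix.trace_add, Matrix.trace_sub, Matrix.trace_sub,
      ← trace_partialTrace (U * Uᴴ * Kᴴ), ← trace_partialTrace (K * (U * Uᴴ)),
      ← trace_partialTrace (K * _ * Kᴴ), hK', partialTrace_mul_kronecker,
      partialTrace_mul_kronecker, hK, partialTrace_kronecker_mul, partialTrace_kronecker_mul,
      hU, hUA, e1, e2, e3]
    have : (s * H * s).trace = (τ * H).trace := by
      rw [Matrix.trace_mul_comm, ← Matrix.mul_assoc, hss]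
    rw [this]
    ring
  have hfg : funcGap U Γ τ θ (fun x => (x + t)⁻¹) = W := rfl
  have h1 := re_trace_nonneg (hΓ.mul_mul_conjTranspose_same W)
  have h2 : (W * A * Wᴴ).trace.re = (W * Γ * Wᴴ).trace.re + t * ‖vec W‖ ^ 2 := by
    rw [hA, Matrix.mul_add, Matrix.add_mul, Matrix.mul_smul, Matrix.mul_one, Matrix.smul_mul,
      Matrix.trace_add, Matrix.trace_smul, Complex.add_re, smul_eq_mul, Complex.re_ofReal_mul,
      norm_vec_sq']
  rw [hfg, ← Complex.sub_re, ← htr, h2]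
  linarith

end Core

/-! ### From resolvents to the square root and the logarithm -/

section Core

variable {n k v : Type*} [Fintype n] [DecidableEq n] [Fintype k] [DecidableEq k] [Fintype v]
  [DecidableEq v]

theorem sub_kronecker_one (A B : Matrix k k ℂ) :
    (A - B) ⊗ₖ (1 : Matrix v v ℂ) = A ⊗ₖ (1 : Matrix v v ℂ) - B ⊗ₖ (1 : Matrix v v ℂ) := by
  ext i j
  simp [sub_mul]

theorem funcGap_sub (U : Matrix (k × v) n ℂ) (Γ : Matrix n n ℂ) (τ θ : Matrix k k ℂ)
    (f g : ℝ → ℝ) :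
    funcGap U Γ τ θ (fun x => f x - g x) = funcGap U Γ τ θ f - funcGap U Γ τ θ g := by
  have h1 := cfc_sub f g Γ (continuousOn_spectrum _ _) (continuousOn_spectrum _ _)
  have h2 := cfc_sub f g (gam τ θ) (continuousOn_spectrum _ _) (continuousOn_spectrum _ _)
  rw [funcGap, h1, h2, funcGap, funcGap, Matrix.mul_sub, Matrix.mul_sub, Matrix.sub_mul,
    sub_kronecker_one, Matrix.sub_mul]
  abel

/-- For a scalar the second term is a multiple of `(suppProj τ ⊗ 1) U`, which is `U`. Hence `t⁻¹`
may be added to a resolvent without changing its gap except in sign conventions. -/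
theorem funcGap_const {U : Matrix (k × v) n ℂ} {Γ : Matrix n n ℂ} {τ θ : Matrix k k ℂ}
    (hΓ : Γ.IsHermitian) (hτ : τ.PosSemidef) (hθ : θ.PosSemidef)
    (hU : partialTrace (U * Uᴴ) = τ) (c : ℝ) : funcGap U Γ τ θ (fun _ => c) = 0 := by
  rw [funcGap, cfc_const c Γ hΓ.isSelfAdjoint,
    cfc_const c (gam τ θ) (posSemidef_gam hθ).1.isSelfAdjoint, Algebra.algebraMap_eq_smul_one,
    Algebra.algebraMap_eq_smul_one, Matrix.mul_smul, Matrix.mul_smul, Matrix.smul_mul,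
    Matrix.mul_one, Matrix.mul_one, psdPow_half_mul_psdPow_neg_half hτ, Matrix.smul_kronecker,
    Matrix.smul_mul, suppProj_kronecker_mul hτ.1 hU, sub_self]

theorem re_trace_mul_cfc_le (U : Matrix (k × v) n ℂ) (Γ : Matrix n n ℂ) (hΓ : Γ.IsHermitian)
    {f : ℝ → ℝ} {c : ℝ} (hf : ∀ x ∈ spectrum ℝ Γ, f x ≤ c) :
    (U * cfc f Γ * Uᴴ).trace.re ≤ c * (U * Uᴴ).trace.re := by
  have h1 : (cfc (fun x => c - f x) Γ).PosSemidef :=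
    posSemidef_cfc fun x hx => sub_nonneg.2 (hf x hx)
  have h2 := re_trace_nonneg (h1.mul_mul_conjTranspose_same U)
  rw [cfc_sub _ _ _ (continuousOn_spectrum _ _) (continuousOn_spectrum _ _),
    cfc_const c Γ hΓ.isSelfAdjoint, Algebra.algebraMap_eq_smul_one, Matrix.mul_sub, Matrix.sub_mul,
    Matrix.mul_smul, Matrix.smul_mul, Matrix.mul_one, Matrix.trace_sub, Matrix.trace_smul,
    Complex.sub_re, Complex.smul_re, smul_eq_mul] at h2
  linarith

theorem re_trace_cfc_le {τ A : Matrix k k ℂ} (hτ : τ.PosSemidef) (hA : A.IsHermitian)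
    {f : ℝ → ℝ} {c : ℝ} (hf : ∀ x ∈ spectrum ℝ A, f x ≤ c) :
    (τ * cfc f A).trace.re ≤ c * τ.trace.re := by
  have h1 : (cfc (fun x => c - f x) A).PosSemidef :=
    posSemidef_cfc fun x hx => sub_nonneg.2 (hf x hx)
  have h2 := re_trace_nonneg (h1.mul_mul_conjTranspose_same (psdPow τ (1 / 2)))
  rw [conjTranspose_psdPow, Matrix.trace_mul_comm, ← Matrix.mul_assoc,
    psdPow_half_mul_psdPow_half hτ,
    cfc_sub _ _ _ (continuousOn_spectrum _ _) (continuousOn_spectrum _ _),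
    cfc_const c A hA.isSelfAdjoint, Algebra.algebraMap_eq_smul_one, Matrix.mul_sub,
    Matrix.mul_smul, Matrix.mul_one, Matrix.trace_sub, Matrix.trace_smul,
    Complex.sub_re, Complex.smul_re, smul_eq_mul] at h2
  linarith

/-- Each of the two terms of the gap has as squared norm an expectation of `f²` in a normalized
state, hence norm at most `c`. This controls the tail of the integral. -/
theorem norm_vec_funcGap_le {U : Matrix (k × v) n ℂ} {Γ : Matrix n n ℂ} {τ θ : Matrix k k ℂ}
    (hΓ : Γ.IsHermitian) (hτ : τ.PosSemidef) (hθ : θ.PosSemidef)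
    (hU : partialTrace (U * Uᴴ) = τ) (htr : τ.trace.re = 1) {f : ℝ → ℝ} {c : ℝ} (hc : 0 ≤ c)
    (hf : ∀ x ∈ spectrum ℝ Γ ∪ spectrum ℝ (gam τ θ), |f x| ≤ c) :
    ‖vec (funcGap U Γ τ θ f)‖ ≤ 2 * c := by
  have hff : ∀ x ∈ spectrum ℝ Γ ∪ spectrum ℝ (gam τ θ), f x * f x ≤ c ^ 2 := fun x hx => by
    rw [← abs_mul_abs_self, sq]
    exact mul_self_le_mul_self (abs_nonneg _) (hf x hx)
  have h1 : ‖vec (U * cfc f Γ)‖ ≤ c := by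
    rw [← sq_le_sq₀ (norm_nonneg _) hc, norm_vec_mul_cfc_sq]
    refine (re_trace_mul_cfc_le U Γ hΓ fun x hx => hff x (Or.inl hx)).trans ?_
    rw [← trace_partialTrace, hU, htr, mul_one]
  have h2 : ‖vec (((psdPow τ (1 / 2) * cfc f (gam τ θ) * psdPow τ (-1 / 2)) ⊗ₖ
      (1 : Matrix v v ℂ)) * U)‖ ≤ c := by
    rw [← sq_le_sq₀ (norm_nonneg _) hc, norm_vec_kronecker_cfc_sq hτ hθ hU]
    refine (re_trace_cfc_le hτ (posSemidef_gam hθ).1 fun x hx => hff x (Or.inr hx)).trans ?_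
    rw [htr, mul_one]
  rw [funcGap, map_sub]
  exact (norm_sub_le _ _).trans (by linarith)

/-- The functional-calculus gap at `√` is controlled by the gap at `-log`. -/
theorem pow_four_funcGap_sqrt_le {U : Matrix (k × v) n ℂ} {Γ : Matrix n n ℂ} {τ θ : Matrix k k ℂ}
    (hΓ : Γ.PosSemidef) (hτ : τ.PosSemidef) (hθ : θ.PosSemidef) (hU : partialTrace (U * Uᴴ) = τ)
    (hUΓ : partialTrace (U * Γ * Uᴴ) = θ) (hθτ : θ * kerProj τ = 0) (htr : τ.trace.re = 1)
    {L : ℝ} (hL : 0 ≤ L) (hΓL : ∀ x ∈ spectrum ℝ Γ, x ≤ L)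
    (hGL : ∀ x ∈ spectrum ℝ (gam τ θ), x ≤ L)
    (hkerΓ : ∀ B : Matrix n n ℂ, Γ * B = 0 → U * B = 0)
    (hkerτ : ∀ B : Matrix k k ℂ, gam τ θ * B = 0 → τ * B = 0) :
    (Real.pi * ‖vec (funcGap U Γ τ θ Real.sqrt)‖) ^ 4 ≤
      256 * L ^ 2 * (-(U * cfc Real.log Γ * Uᴴ).trace.re +
        (τ * cfc Real.log (gam τ θ)).trace.re) := by
  have hG := posSemidef_gam (σ := τ) hθ
  obtain ⟨x, P, hx, -, hPx, hP⟩ := exists_resolution hΓ.1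
  obtain ⟨y, Q, hy, -, hQy, hQ⟩ := exists_resolution hG.1
  let ΦU : Matrix n n ℂ →ₗ[ℂ] EuclideanSpace ℂ ((k × v) × n) :=
    { toFun := fun X => vec (U * X)
      map_add' := fun X Y => by rw [Matrix.mul_add, map_add]
      map_smul' := fun r X => by rw [Matrix.mul_smul, map_smul, RingHom.id_apply] }
  let Φτ : Matrix k k ℂ →ₗ[ℂ] EuclideanSpace ℂ ((k × v) × n) :=
    { toFun := fun X => vec (((psdPow τ (1 / 2) * X * psdPow τ (-1 / 2)) ⊗ₖ
        (1 : Matrix v v ℂ)) * U)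
      map_add' := fun X Y => by
        rw [Matrix.mul_add, Matrix.add_mul, Matrix.add_kronecker, Matrix.add_mul, map_add]
      map_smul' := fun r X => by
        rw [Matrix.mul_smul, Matrix.smul_mul, Matrix.smul_kronecker, Matrix.smul_mul, map_smul,
          RingHom.id_apply] }
  -- The spectral data of `Γ` and of `gam τ θ`, the latter with a minus sign, form one family
  -- indexed by `n ⊕ k`. Gaps and differences of expectations then become finite sums over it.
  let z : n ⊕ k → ℝ := Sum.elim x y
  let a : n ⊕ k → EuclideanSpace ℂ ((k × v) × n) :=
    Sum.elim (fun i => ΦU (P i)) (fun j => -Φτ (Q j))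
  let c : n ⊕ k → ℝ :=
    Sum.elim (fun i => (U * P i * Uᴴ).trace.re) (fun j => -(τ * Q j).trace.re)
  have hsum : ∀ f : ℝ → ℝ, ∑ i, f (z i) • a i = vec (funcGap U Γ τ θ f) := by
    intro f
    have h1 : vec (funcGap U Γ τ θ f) = ΦU (cfc f Γ) - Φτ (cfc f (gam τ θ)) := by
      rw [funcGap, map_sub]
      rfl
    have h2 : ∀ (r : ℝ) X, ΦU ((r : ℂ) • X) = r • ΦU X := fun r X => by
      rw [ΦU.map_smul, Complex.coe_smul]
    have h3 : ∀ (r : ℝ) X, Φτ ((r : ℂ) • X) = r • Φτ X := fun r X => by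
      rw [Φτ.map_smul, Complex.coe_smul]
    rw [h1, hP, hQ, map_sum, map_sum, Fintype.sum_sum_type]
    simp only [z, a, Sum.elim_inl, Sum.elim_inr, smul_neg, Finset.sum_neg_distrib,
      sub_eq_add_neg, h2, h3]
  have hqsum : ∀ f : ℝ → ℝ, ∑ i, c i * f (z i) =
      (U * cfc f Γ * Uᴴ).trace.re - (τ * cfc f (gam τ θ)).trace.re := by
    intro f
    rw [hP, hQ, Fintype.sum_sum_type]
    simp only [z, c, Sum.elim_inl, Sum.elim_inr, Matrix.mul_sum, Matrix.sum_mul, Matrix.mul_smul,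
      Matrix.smul_mul, Matrix.trace_sum, Matrix.trace_smul, Complex.re_sum, smul_eq_mul,
      Complex.re_ofReal_mul, mul_neg, Finset.sum_neg_distrib, sub_eq_add_neg, mul_comm]
  have hspec : ∀ i, z i ∈ spectrum ℝ Γ ∪ spectrum ℝ (gam τ θ) := by
    rintro (i | j)
    · exact Or.inl (hx i)
    · exact Or.inr (hy j)
  have hbound : ∀ s ∈ spectrum ℝ Γ ∪ spectrum ℝ (gam τ θ), 0 ≤ s ∧ s ≤ L := by
    rintro s (hs | hs)
    · exact ⟨spectrum_nonneg hΓ hs, hΓL s hs⟩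
    · exact ⟨spectrum_nonneg hG hs, hGL s hs⟩
  have hdiff : ∀ t : ℝ, vec (funcGap U Γ τ θ fun x => t⁻¹ - (x + t)⁻¹) =
      -vec (funcGap U Γ τ θ fun x => (x + t)⁻¹) := fun t => by
    rw [funcGap_sub U Γ τ θ (fun _ => t⁻¹), funcGap_const hΓ.1 hτ hθ hU, zero_sub, map_neg]
  have key := pow_four_sqrt_gap_le_log_gap z c a hL (fun i => (hbound _ (hspec i)).1) ?_ ?_ ?_ ?_
  · rw [hsum Real.sqrt] at key
    refine key.trans (le_of_eq ?_)
    have h1 := hqsum Real.log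
    simp only [mul_neg, Finset.sum_neg_distrib]
    rw [h1]
    ring
  -- A spectral projection at eigenvalue `0` has weight zero, by the two kernel hypotheses.
  · rintro (i | j) h
    · have h : x i = 0 := h
      have h1 : Γ * P i = 0 := by rw [hPx, h]; simp
      simp [c, hkerΓ _ h1]
    · have h : y j = 0 := h
      have h1 : gam τ θ * Q j = 0 := by rw [hQy, h]; simp
      simp [c, hkerτ _ h1]
  -- The total weight vanishes because both halves contribute `tr τ`.
  · have h1 := hqsum fun _ => 1
    rw [cfc_const_one ℝ Γ hΓ.1.isSelfAdjoint, cfc_const_one ℝ (gam τ θ) hG.1.isSelfAdjoint,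
      Matrix.mul_one, Matrix.mul_one, ← trace_partialTrace, hU, sub_self] at h1
    simpa using h1
  · intro t ht
    have h1 := hsum fun x => t⁻¹ - (x + t)⁻¹
    have h2 := hqsum fun x => (x + t)⁻¹
    rw [h1, h2, hdiff, norm_neg]
    exact funcGap_resolvent hΓ hτ hθ hU hUΓ hθτ ht
  · intro t ht
    have h1 := hsum fun x => t⁻¹ - (x + t)⁻¹
    rw [h1, mul_div_assoc]
    refine norm_vec_funcGap_le hΓ.1 hτ hθ hU htr (by positivity) fun s hs => ?_
    obtain ⟨hs0, hsL⟩ := hbound s hs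
    -- For `0 ≤ s ≤ L` this is at most `L / t²`, the decay required of the tail.
    have h2 : t⁻¹ - (s + t)⁻¹ = s / (t * (s + t)) := by
      field_simp
      ring
    rw [h2, abs_of_nonneg (by positivity), sq]
    gcongr
    linarith

end Core

/-! ### The limits defining the BS-entropy -/

section Regularization

variable {n : Type*} [Fintype n] [DecidableEq n]

theorem spectrum_pos {A : Matrix n n ℂ} (hA : A.PosDef) {x : ℝ} (hx : x ∈ spectrum ℝ A) :
    0 < x := by
  obtain ⟨i, rfl⟩ := hA.1.spectrum_real_eq_range_eigenvalues ▸ hx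
  exact hA.eigenvalues_pos i

theorem posDef_of_mul_eq_one {A B : Matrix n n ℂ} (hA : A.PosSemidef) (h : A * B = 1) :
    A.PosDef := by
  rw [hA.posDef_iff_isUnit]
  exact IsUnit.of_mul_eq_one B h

theorem posDef_cfc {A : Matrix n n ℂ} {f : ℝ → ℝ} (hA : A.IsHermitian)
    (hf : ∀ x ∈ spectrum ℝ A, 0 < f x) : (cfc f A).PosDef := by
  refine posDef_of_mul_eq_one (B := cfc (fun x => (f x)⁻¹) A)
    (posSemidef_cfc fun x hx => (hf x hx).le) ?_
  rw [cfc_mul_cfc, ← cfc_one ℝ A hA.isSelfAdjoint]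
  exact cfc_congr fun x hx => mul_inv_cancel₀ (hf x hx).ne'

open scoped Matrix.Norms.L2Operator in
theorem continuousOn_cfc_posDef {f : ℝ → ℝ} (hf : ContinuousOn f (Set.Ioi 0))
    {a : ℝ → Matrix n n ℂ} {t : Set ℝ} (ha : ContinuousOn a t) (hpos : ∀ x ∈ t, (a x).PosDef) :
    ContinuousOn (fun x => cfc f (a x)) t := by
  refine ContinuousOn.cfc_of_mem_nhdsSet (s := Set.Ioi 0) f ?_ ha
    (fun x hx => (hpos x hx).1.isSelfAdjoint) hf
  refine isOpen_Ioi.mem_nhdsSet.2 ?_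
  simp only [Set.iUnion_subset_iff]
  exact fun x hx y hy => spectrum_pos (hpos x hx) hy

theorem posDef_gam {σ ρ : Matrix n n ℂ} (hσ : σ.PosDef) (hρ : ρ.PosDef) : (gam σ ρ).PosDef := by
  have h1 : suppProj σ = 1 := by
    rw [suppProj, ← cfc_one ℝ σ hσ.1.isSelfAdjoint]
    refine cfc_congr fun x hx => ?_
    simp [(spectrum_pos hσ hx).ne']
  refine posDef_of_mul_eq_one (B := psdPow σ (1 / 2) * ρ⁻¹ * psdPow σ (1 / 2))
    (posSemidef_gam hρ.posSemidef) ?_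
  have h2 : ρ * ρ⁻¹ = 1 := Matrix.mul_nonsing_inv _ ((Matrix.isUnit_iff_isUnit_det _).1 hρ.isUnit)
  calc gam σ ρ * (psdPow σ (1 / 2) * ρ⁻¹ * psdPow σ (1 / 2))
      = psdPow σ (-1 / 2) * ρ * (psdPow σ (-1 / 2) * psdPow σ (1 / 2)) * ρ⁻¹ *
          psdPow σ (1 / 2) := by simp only [gam, Matrix.mul_assoc]
    _ = psdPow σ (-1 / 2) * (ρ * ρ⁻¹) * psdPow σ (1 / 2) := by
      rw [psdPow_neg_half_mul_psdPow_half hσ.posSemidef, h1, Matrix.mul_one]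
      simp only [Matrix.mul_assoc]
    _ = 1 := by
      rw [h2, Matrix.mul_one, psdPow_neg_half_mul_psdPow_half hσ.posSemidef, h1]

theorem psdPow_cfc {A : Matrix n n ℂ} (hA : A.IsHermitian) (f : ℝ → ℝ) (s : ℝ) :
    psdPow (cfc f A) s = cfc (fun x => f x ^ s) A := by
  rw [psdPow]
  exact (cfc_comp' (fun x => x ^ s) f A
    ((Matrix.finite_real_spectrum.image f).continuousOn _)
    (continuousOn_spectrum f A) hA.isSelfAdjoint).symm

theorem kerProj_eq_kerProj {σ ρ : Matrix n n ℂ} (hσ : σ.IsHermitian) (hρ : ρ.IsHermitian)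
    (h : ρ * kerProj σ = 0) (h' : σ * kerProj ρ = 0) : kerProj σ = kerProj ρ := by
  have h1 : kerProj ρ * kerProj σ = kerProj σ := by
    have := cfc_mul_of_mul_eq_zero (fun x : ℝ => if x = 0 then 1 else 0) hρ h
    rwa [if_pos rfl, Complex.ofReal_one, one_smul] at this
  have h2 : kerProj σ * kerProj ρ = kerProj ρ := by
    have := cfc_mul_of_mul_eq_zero (fun x : ℝ => if x = 0 then 1 else 0) hσ h'
    rwa [if_pos rfl, Complex.ofReal_one, one_smul] at this
  have h3 := congrArg Matrix.conjTranspose h1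
  rw [Matrix.conjTranspose_mul, (isHermitian_kerProj σ).eq, (isHermitian_kerProj ρ).eq, h2] at h3
  exact h3.symm

/-- `A + Q' + ε Q`, where `Q` and `Q'` are the projections onto support and kernel of `A`. -/
noncomputable def suppShift (A : Matrix n n ℂ) (ε : ℝ) : Matrix n n ℂ :=
  A + kerProj A + (ε : ℂ) • suppProj A

theorem suppShift_eq_cfc {A : Matrix n n ℂ} (hA : A.IsHermitian) (ε : ℝ) :
    suppShift A ε = cfc (fun x : ℝ => x + (if x = 0 then 1 else 0) +
      ε * (if x = 0 then 0 else 1)) A := by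
  rw [cfc_add _ _ _ (continuousOn_spectrum _ _) (continuousOn_spectrum _ _),
    cfc_add _ _ _ (continuousOn_spectrum _ _) (continuousOn_spectrum _ _),
    cfc_const_mul _ _ _ (continuousOn_spectrum _ _), cfc_id' ℝ A hA.isSelfAdjoint]
  rfl

theorem posDef_suppShift {A : Matrix n n ℂ} (hA : A.PosSemidef) {ε : ℝ} (hε : 0 ≤ ε) :
    (suppShift A ε).PosDef := by
  rw [suppShift_eq_cfc hA.1]
  refine posDef_cfc hA.1 fun x hx => ?_
  have hx0 := spectrum_nonneg hA hx
  by_cases h : x = 0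
  · simp [h]
  · have : 0 < x := lt_of_le_of_ne hx0 (Ne.symm h)
    simp only [h, if_false]
    positivity

theorem add_smul_one_eq_cfc {A : Matrix n n ℂ} (hA : A.IsHermitian) (ε : ℝ) :
    A + (ε : ℂ) • (1 : Matrix n n ℂ) = cfc (fun x : ℝ => x + ε) A := by
  rw [cfc_add _ _ _ (continuousOn_spectrum _ _) (continuousOn_spectrum _ _),
    cfc_const ε A hA.isSelfAdjoint, cfc_id' ℝ A hA.isSelfAdjoint,
    Algebra.algebraMap_eq_smul_one]
  rfl

/-- On the common kernel both regularized operators are `ε`, and `ε^{-1/2} ε ε^{-1/2} = 1`. So the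
kernel block may be replaced by the identity in both arguments, which keeps them invertible as `ε →
0`. -/
theorem gam_add_smul_one {σ ρ : Matrix n n ℂ} (hσ : σ.PosSemidef) (hρ : ρ.PosSemidef)
    (hker : kerProj σ = kerProj ρ) {ε : ℝ} (hε : 0 < ε) :
    gam (σ + (ε : ℂ) • (1 : Matrix n n ℂ)) (ρ + (ε : ℂ) • (1 : Matrix n n ℂ)) =
      gam (suppShift σ ε) (suppShift ρ ε) := by
  have hsupp : suppProj σ = suppProj ρ := by
    rw [← add_left_inj (kerProj σ), suppProj_add_kerProj hσ.1, hker, suppProj_add_kerProj hρ.1]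
  -- `κ` is `ε^{-1/2}` on the kernel and `1` on the support; it is split off from each inverse root
  -- and absorbed into the middle factor.
  set κ : Matrix n n ℂ := cfc (fun x : ℝ => if x = 0 then ε ^ (-1 / 2 : ℝ) else 1) σ with hκ
  have h1 : psdPow (σ + (ε : ℂ) • 1) (-1 / 2) = psdPow (suppShift σ ε) (-1 / 2) * κ := by
    rw [add_smul_one_eq_cfc hσ.1, suppShift_eq_cfc hσ.1, psdPow_cfc hσ.1, psdPow_cfc hσ.1, hκ,
      cfc_mul_cfc]
    refine cfc_congr fun x _ => ?_
    by_cases h : x = 0 <;> simp [h]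
  have h2 : psdPow (σ + (ε : ℂ) • 1) (-1 / 2) = κ * psdPow (suppShift σ ε) (-1 / 2) := by
    rw [add_smul_one_eq_cfc hσ.1, suppShift_eq_cfc hσ.1, psdPow_cfc hσ.1, psdPow_cfc hσ.1, hκ,
      cfc_mul_cfc]
    refine cfc_congr fun x _ => ?_
    by_cases h : x = 0 <;> simp [h]
  have hκ' : κᴴ = κ := conjTranspose_cfc _ _
  have hQκ : suppProj σ * κ = suppProj σ := by
    rw [suppProj, hκ, cfc_mul_cfc]
    refine cfc_congr fun x _ => ?_
    by_cases h : x = 0 <;> simp [h]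
  have hρκ : ρ * κ = ρ := by
    rw [← mul_suppProj hρ.1, ← hsupp, Matrix.mul_assoc, hQκ]
  have hκρ : κ * ρ = ρ := by
    have := congrArg Matrix.conjTranspose hρκ
    rwa [Matrix.conjTranspose_mul, hκ', hρ.1.eq] at this
  have hκκ : (ε : ℂ) • (κ * κ) = kerProj σ + (ε : ℂ) • suppProj σ := by
    have e1 : (ε : ℂ) • suppProj σ = cfc (fun x : ℝ => ε * if x = 0 then 0 else 1) σ :=
      (cfc_const_mul ε _ σ (continuousOn_spectrum _ _)).symm
    have e2 : (ε : ℂ) • (κ * κ) = cfc (fun x : ℝ => ε * ((if x = 0 then ε ^ (-1 / 2 : ℝ) else 1) *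
        (if x = 0 then ε ^ (-1 / 2 : ℝ) else 1))) σ := by
      rw [hκ, cfc_mul_cfc]
      exact (cfc_const_mul ε _ σ (continuousOn_spectrum _ _)).symm
    rw [e1, e2, kerProj, ← cfc_add _ _ _ (continuousOn_spectrum _ _) (continuousOn_spectrum _ _)]
    refine cfc_congr fun x _ => ?_
    by_cases h : x = 0
    · have : ε * (ε ^ (-1 / 2 : ℝ) * ε ^ (-1 / 2 : ℝ)) = 1 := by
        rw [← Real.rpow_add hε]
        norm_num [Real.rpow_neg_one, hε.ne']
      simp [h, this]
    · simp [h]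
  have h3 : κ * (ρ + (ε : ℂ) • (1 : Matrix n n ℂ)) * κ = suppShift ρ ε := by
    rw [Matrix.mul_add, Matrix.add_mul, hκρ, hρκ, Matrix.mul_smul, Matrix.smul_mul, Matrix.mul_one,
      hκκ, suppShift, hker, hsupp, add_assoc]
  rw [gam]
  nth_rewrite 1 [h1]
  rw [h2, gam, ← h3]
  simp only [Matrix.mul_assoc]

theorem gam_suppShift_zero {σ ρ : Matrix n n ℂ} (hσ : σ.PosSemidef) (hρ : ρ.PosSemidef)
    (hker : kerProj σ = kerProj ρ) :
    gam (suppShift σ 0) (suppShift ρ 0) = gam σ ρ + kerProj σ := by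
  have h1 : psdPow (suppShift σ 0) (-1 / 2) = psdPow σ (-1 / 2) + kerProj σ := by
    rw [suppShift_eq_cfc hσ.1, psdPow_cfc hσ.1, psdPow, kerProj,
      ← cfc_add _ _ _ (continuousOn_spectrum _ _) (continuousOn_spectrum _ _)]
    refine cfc_congr fun x _ => ?_
    by_cases h : x = 0
    · simp [h]
    · simp [h]
  have h2 : psdPow σ (-1 / 2) * kerProj σ = 0 := by
    rw [psdPow, kerProj, cfc_mul_cfc, ← cfc_zero ℝ σ]
    refine cfc_congr fun x _ => ?_
    by_cases h : x = 0 <;> simp [h]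
  have h3 : ρ * kerProj σ = 0 := by rw [hker, mul_kerProj hρ.1]
  have h4 : kerProj σ * ρ = 0 := by
    have := congrArg Matrix.conjTranspose h3
    rwa [Matrix.conjTranspose_mul, (isHermitian_kerProj σ).eq, hρ.1.eq,
      Matrix.conjTranspose_zero] at this
  have h5 : kerProj σ * psdPow σ (-1 / 2) = 0 := by
    have := congrArg Matrix.conjTranspose h2
    rwa [Matrix.conjTranspose_mul, (isHermitian_kerProj σ).eq, conjTranspose_psdPow,
      Matrix.conjTranspose_zero] at this
  have h6 := kerProj_mul_kerProj σ
  rw [gam, h1, suppShift, ← hker, gam]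
  simp only [Complex.ofReal_zero, zero_smul, add_zero, Matrix.mul_add, Matrix.add_mul, h2, h4, h6,
    Matrix.mul_assoc, h3, h5, Matrix.mul_zero, zero_add]

/-- The regularized expressions converge to the formula evaluated with inverses on the support. -/
theorem tendsto_bsRegularized {σ ρ : Matrix n n ℂ} (hσ : σ.PosSemidef) (hρ : ρ.PosSemidef)
    (h : ρ * kerProj σ = 0) (h' : σ * kerProj ρ = 0) :
    Tendsto (bsRegularized σ ρ) (𝓝[>] (0 : ℝ)) (𝓝 (bsFormula σ ρ)) := by
  have hker := kerProj_eq_kerProj hσ.1 hρ.1 h h'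
  -- The shifted matrices stay positive definite at `ε = 0`, so the inverse root and the logarithm
  -- are continuous on the closed half-line.
  set a : ℝ → Matrix n n ℂ := fun ε => gam (suppShift σ ε) (suppShift ρ ε) with ha
  have hshift : ∀ A : Matrix n n ℂ, Continuous fun ε : ℝ => suppShift A ε := fun A => by
    unfold suppShift
    fun_prop
  have hroot : ContinuousOn (fun ε => psdPow (suppShift σ ε) (-1 / 2)) (Set.Ici 0) :=
    continuousOn_cfc_posDef (f := fun x => x ^ (-1 / 2 : ℝ))
      (fun x hx => (Real.continuousAt_rpow_const x _
        (Or.inl (ne_of_gt hx))).continuousWithinAt) (hshift σ).continuousOn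
      fun ε hε => posDef_suppShift hσ hε
  have hacont : ContinuousOn a (Set.Ici 0) := (hroot.mul (hshift ρ).continuousOn).mul hroot
  have hlog : ContinuousOn (fun ε => cfc Real.log (a ε)) (Set.Ici 0) :=
    continuousOn_cfc_posDef (fun x hx => (Real.continuousAt_log (ne_of_gt hx)).continuousWithinAt)
      hacont fun ε hε => posDef_gam (posDef_suppShift hσ hε) (posDef_suppShift hρ hε)
  have hF : ContinuousOn (fun ε : ℝ => -((σ + (ε : ℂ) • (1 : Matrix n n ℂ)) *
      cfc Real.log (a ε)).trace.re) (Set.Ici 0) := by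
    have h1 : ContinuousOn (fun ε : ℝ => (σ + (ε : ℂ) • (1 : Matrix n n ℂ)) *
        cfc Real.log (a ε)) (Set.Ici 0) :=
      ContinuousOn.mul (by fun_prop) hlog
    exact (Complex.continuous_re.comp_continuousOn
      (Continuous.comp_continuousOn (continuous_id.matrix_trace) h1)).neg
  have hF0 := (hF 0 Set.self_mem_Ici).mono_left (nhdsWithin_mono _ Set.Ioi_subset_Ici_self)
  -- At `ε = 0` the argument of the logarithm is `Γ` plus the kernel projection. It agrees with `Γ`
  -- on the support of `σ`, which is all the trace against `σ` sees.
  have hlim : -((σ + ((0 : ℝ) : ℂ) • (1 : Matrix n n ℂ)) * cfc Real.log (a 0)).trace.re =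
      bsFormula σ ρ := by
    have hG := posSemidef_gam (σ := σ) hρ
    have h1 : (gam σ ρ + kerProj σ) * suppProj σ = suppProj σ * gam σ ρ := by
      have h2 : kerProj σ * suppProj σ = 0 := by
        rw [kerProj, suppProj, cfc_mul_cfc, ← cfc_zero ℝ σ]
        refine cfc_congr fun x _ => ?_
        by_cases h : x = 0 <;> simp [h]
      rw [Matrix.add_mul, h2, gam_mul_suppProj, suppProj_mul_gam, add_zero]
    have h2 := cfc_intertwine Real.log (hG.1.add (isHermitian_kerProj σ)) hG.1 h1
    have h3 : suppProj σ * σ = σ := by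
      have := congrArg Matrix.conjTranspose (mul_suppProj hσ.1)
      rwa [Matrix.conjTranspose_mul, (isHermitian_suppProj σ).eq, hσ.1.eq] at this
    rw [ha, bsFormula]
    simp only [gam_suppShift_zero hσ hρ hker, Complex.ofReal_zero, zero_smul, add_zero]
    congr 2
    set C := cfc Real.log (gam σ ρ + kerProj σ)
    set l := cfc Real.log (gam σ ρ)
    calc (σ * C).trace = (C * suppProj σ * σ).trace := by
          rw [Matrix.trace_mul_comm, Matrix.mul_assoc, h3]
      _ = (l * (σ * suppProj σ)).trace := by
          rw [h2, Matrix.mul_assoc, Matrix.trace_mul_comm, Matrix.mul_assoc]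
      _ = _ := by rw [mul_suppProj hσ.1, Matrix.trace_mul_comm]
  rw [← hlim]
  refine hF0.congr' ?_
  filter_upwards [self_mem_nhdsWithin] with ε hε
  rw [bsRegularized, bsFormula, gam_add_smul_one hσ hρ hker hε]

theorem bsEntropy_eq_bsFormula {σ ρ : Matrix n n ℂ} (hσ : σ.PosSemidef) (hρ : ρ.PosSemidef)
    (h : ρ * kerProj σ = 0) (h' : σ * kerProj ρ = 0) : bsEntropy σ ρ = bsFormula σ ρ := by
  rw [bsEntropy]
  split_ifs
  · rfl
  · exact (tendsto_bsRegularized hσ hρ h h').limUnder_eq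

end Regularization

/-! ### Projection onto a matrix algebra and Stinespring dilations -/

section Stinespring

variable {n k : Type*} [Fintype n] [DecidableEq n] [Fintype k] [DecidableEq k]

theorem re_trace_mul_nonneg {A B : Matrix n n ℂ} (hA : A.PosSemidef) (hB : B.PosSemidef) :
    0 ≤ (A * B).trace.re := by
  have h := re_trace_nonneg (hB.mul_mul_conjTranspose_same (psdPow A (1 / 2)))
  rwa [conjTranspose_psdPow, Matrix.trace_mul_comm, ← Matrix.mul_assoc,
    psdPow_half_mul_psdPow_half hA] at h

theorem cfc_mem_starSubalgebra (S : StarSubalgebra ℂ (Matrix n n ℂ)) (f : ℝ → ℝ)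
    {A : Matrix n n ℂ} (hA : A ∈ S) : cfc f A ∈ S := by
  have : IsClosed (S : Set (Matrix n n ℂ)) :=
    Submodule.closed_of_finiteDimensional (Subalgebra.toSubmodule S.toSubalgebra)
  exact cfc_mem (𝕜' := ℂ) _ hA

/-- The Hilbert-Schmidt projection of a positive semidefinite matrix onto a matrix algebra is
positive semidefinite. -/
theorem posSemidef_of_trace_eq (S : StarSubalgebra ℂ (Matrix n n ℂ)) {X Y : Matrix n n ℂ}
    (hX : X.PosSemidef) (hY : Y ∈ S) (h : ∀ A ∈ S, (Yᴴ * A).trace = (Xᴴ * A).trace) :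
    Y.PosSemidef := by
  have hYs : Yᴴ ∈ S := star_mem hY
  have hherm : Y.IsHermitian := by
    have h1 : ∀ A ∈ S, (Y * A).trace = (Xᴴ * A).trace := by
      intro A hA
      have h2 := congrArg star (h Aᴴ (star_mem hA))
      rw [← Matrix.trace_conjTranspose, ← Matrix.trace_conjTranspose, Matrix.conjTranspose_mul,
        Matrix.conjTranspose_mul, Matrix.conjTranspose_conjTranspose,
        Matrix.conjTranspose_conjTranspose, Matrix.conjTranspose_conjTranspose,
        Matrix.trace_mul_comm, Matrix.trace_mul_comm A X] at h2
      rw [h2, hX.1.eq]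
    have h2 : ((Yᴴ - Y)ᴴ * (Yᴴ - Y)).trace = 0 := by
      have hm : Yᴴ - Y ∈ S := sub_mem hYs hY
      rw [Matrix.conjTranspose_sub, Matrix.conjTranspose_conjTranspose, Matrix.sub_mul,
        Matrix.trace_sub, h _ hm, h1 _ hm, sub_self]
    exact sub_eq_zero.1 (Matrix.trace_conjTranspose_mul_self_eq_zero_iff.1 h2)
  -- The negative part `N` of `Y` lies in the algebra, so it may be tested: `tr[Y N] = -tr[N²]`,
  -- while `tr[X N] ≥ 0`. Hence `N = 0`.
  set N := cfc (fun t : ℝ => max (-t) 0) Y with hN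
  have hNS : N ∈ S := cfc_mem_starSubalgebra S _ hY
  have hNpos : N.PosSemidef := posSemidef_cfc fun x _ => le_max_right _ _
  have hid : cfc (fun t : ℝ => t) Y = Y := cfc_id' ℝ Y hherm.isSelfAdjoint
  have hYN : Y * N + Nᴴ * N = 0 := by
    nth_rewrite 1 [← hid]
    rw [hNpos.1.eq, hN, cfc_mul_cfc, cfc_mul_cfc,
      ← cfc_add _ _ _ (continuousOn_spectrum _ _) (continuousOn_spectrum _ _), ← cfc_zero ℝ Y]
    refine cfc_congr fun x _ => ?_
    simp only [Pi.zero_apply]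
    rcases le_total (-x) 0 with hx | hx
    · simp [max_eq_right hx]
    · simp [max_eq_left hx]
  have hN0 : N = 0 := by
    rw [← Matrix.trace_conjTranspose_mul_self_eq_zero_iff]
    have h1 := h N hNS
    rw [hherm.eq, hX.1.eq] at h1
    have h2 := re_trace_mul_nonneg hX hNpos
    have h3 := congrArg (fun A => A.trace.re) hYN
    simp only [Matrix.trace_add, Matrix.trace_zero, Complex.add_re, Complex.zero_re, h1] at h3
    have h4 := (Matrix.posSemidef_conjTranspose_mul_self N).trace_nonneg
    have h5 := Complex.le_def.1 h4
    refine Complex.ext (le_antisymm ?_ h5.1) h5.2.symm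
    rw [Complex.zero_re]
    linarith
  have hfin : Y = cfc (fun t : ℝ => t + max (-t) 0) Y := by
    rw [cfc_add _ _ _ (continuousOn_spectrum _ _) (continuousOn_spectrum _ _), hid, ← hN, hN0,
      add_zero]
  rw [hfin]
  exact posSemidef_cfc fun x _ => by linarith [le_max_left (-x) 0]

/-- The Hilbert-Schmidt projection onto a matrix algebra. -/
noncomputable def condExpect (M : StarSubalgebra ℂ (Matrix n n ℂ)) : Matrix n n ℂ →ₗ[ℂ] M :=
  hsAdjoint (M := M) (N := ⊤)
      (StarSubalgebra.inclusion (le_top : M ≤ ⊤)).toAlgHom.toLinearMap ∘ₗ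
    { toFun := fun A => (⟨A, StarSubalgebra.mem_top⟩ : (⊤ : StarSubalgebra ℂ (Matrix n n ℂ)))
      map_add' := fun _ _ => rfl
      map_smul' := fun _ _ => rfl }

theorem trace_condExpect_mul (M : StarSubalgebra ℂ (Matrix n n ℂ)) (B : Matrix n n ℂ) (A : M) :
    ((condExpect M B : Matrix n n ℂ)ᴴ * (A : Matrix n n ℂ)).trace =
      (Bᴴ * (A : Matrix n n ℂ)).trace :=
  hsAdjoint_spec (M := M) (N := ⊤) _ ⟨B, StarSubalgebra.mem_top⟩ A

theorem condExpect_coe (M : StarSubalgebra ℂ (Matrix n n ℂ)) (A : M) :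
    condExpect M (A : Matrix n n ℂ) = A := by
  have h := trace_condExpect_mul M A (condExpect M (A : Matrix n n ℂ) - A)
  refine Subtype.ext (sub_eq_zero.1 (Matrix.trace_conjTranspose_mul_self_eq_zero_iff.1 ?_))
  rw [Matrix.conjTranspose_sub, Matrix.sub_mul, Matrix.trace_sub]
  exact sub_eq_zero.2 h

theorem trace_condExpect (M : StarSubalgebra ℂ (Matrix n n ℂ)) (B : Matrix n n ℂ) :
    (condExpect M B : Matrix n n ℂ).trace = B.trace := by
  have h := trace_condExpect_mul M B 1
  rw [OneMemClass.coe_one, Matrix.mul_one, Matrix.mul_one, Matrix.trace_conjTranspose,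
    Matrix.trace_conjTranspose] at h
  exact star_injective h

/-- The algebra of block matrices with all blocks in `M`. -/
def blockAlgebra (m : Type*) [Fintype m] [DecidableEq m] (M : StarSubalgebra ℂ (Matrix n n ℂ)) :
    StarSubalgebra ℂ (Matrix (m × n) (m × n) ℂ) where
  carrier := {X | ∀ i j, (Matrix.comp m m n n ℂ).symm X i j ∈ M}
  mul_mem' {X Y} hX hY i j := by
    have : (Matrix.comp m m n n ℂ).symm (X * Y) i j =
        ∑ l, (Matrix.comp m m n n ℂ).symm X i l * (Matrix.comp m m n n ℂ).symm Y l j := by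
      ext a b
      simp [Matrix.mul_apply, Matrix.sum_apply, Fintype.sum_prod_type]
    rw [this]
    exact sum_mem fun l _ => mul_mem (hX i l) (hY l j)
  add_mem' hX hY i j := add_mem (hX i j) (hY i j)
  algebraMap_mem' r i j := by
    by_cases h : i = j
    · have : (Matrix.comp m m n n ℂ).symm (algebraMap ℂ _ r) i j = algebraMap ℂ _ r := by
        ext a b
        simp [Matrix.algebraMap_matrix_apply, h]
      rw [this]
      exact algebraMap_mem M r
    · have : (Matrix.comp m m n n ℂ).symm (algebraMap ℂ _ r) i j = 0 := by
        ext a b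
        simp [Matrix.algebraMap_matrix_apply, h]
      rw [this]
      exact zero_mem M
  star_mem' {X} hX i j := star_mem (hX j i)

theorem trace_conjTranspose_mul_eq_sum_blocks {m : Type*} [Fintype m]
    (X Y : Matrix (m × n) (m × n) ℂ) :
    (Xᴴ * Y).trace = ∑ i, ∑ j, (((Matrix.comp m m n n ℂ).symm X j i)ᴴ *
      (Matrix.comp m m n n ℂ).symm Y j i).trace := by
  simp only [Matrix.trace, Matrix.diag_apply, Matrix.mul_apply, Fintype.sum_prod_type,
    Matrix.conjTranspose_apply, Matrix.comp_symm_apply]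
  refine Finset.sum_congr rfl fun i _ => ?_
  rw [Finset.sum_comm]

/-- The Choi matrix of the Hilbert-Schmidt projection onto `M` is positive semidefinite. -/
theorem posSemidef_choi_condExpect (M : StarSubalgebra ℂ (Matrix n n ℂ)) {m : Type*} [Fintype m]
    [DecidableEq m] (e : m → n) :
    (Matrix.comp m m n n ℂ (Matrix.of fun i j =>
      (condExpect M (Matrix.single (e i) (e j) 1) : Matrix n n ℂ))).PosSemidef := by
  -- This rank-one matrix has the matrix units as blocks, and the Choi matrix is its Hilbert-Schmidt
  -- projection onto the block algebra.
  have hX := Matrix.posSemidef_vecMulVec_self_star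
    (fun p : m × n => if e p.1 = p.2 then (1 : ℂ) else 0)
  refine posSemidef_of_trace_eq (blockAlgebra m M) hX ?_ ?_
  · intro i j
    simp
  · intro A hA
    rw [trace_conjTranspose_mul_eq_sum_blocks, trace_conjTranspose_mul_eq_sum_blocks]
    refine Finset.sum_congr rfl fun i _ => Finset.sum_congr rfl fun j _ => ?_
    have h1 : (Matrix.comp m m n n ℂ).symm (Matrix.vecMulVec
        (fun p : m × n => if e p.1 = p.2 then (1 : ℂ) else 0)
        (star fun p : m × n => if e p.1 = p.2 then (1 : ℂ) else 0)) j i =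
        Matrix.single (e j) (e i) 1 := by
      ext a b
      simp only [Matrix.comp_symm_apply, Matrix.vecMulVec_apply, Pi.star_apply,
        Matrix.single_apply]
      split_ifs <;> simp_all
    rw [h1, Equiv.symm_apply_apply]
    exact trace_condExpect_mul M (Matrix.single (e j) (e i) 1)
      ⟨(Matrix.comp m m n n ℂ).symm A j i, hA j i⟩

/-- Existence of Stinespring dilations. -/
theorem exists_stinespring {M : StarSubalgebra ℂ (Matrix n n ℂ)}
    {N : StarSubalgebra ℂ (Matrix k k ℂ)} {T : M →ₗ[ℂ] N} (hT : IsQuantumChannel T) :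
    ∃ V : Matrix (k × (n × k)) n ℂ, Vᴴ * V = 1 ∧
      ∀ ω : M, (T ω : Matrix k k ℂ) = partialTrace (V * (ω : Matrix n n ℂ) * Vᴴ) := by
  let e := Fintype.equivFin n
  -- The Choi matrix of `T` composed with the projection onto `M`. The columns of its square root
  -- are the Kraus operators, so the environment is indexed by `n × k`.
  set C : Matrix (n × k) (n × k) ℂ := Matrix.of fun x y =>
    (T (condExpect M (Matrix.single x.1 y.1 1)) : Matrix k k ℂ) x.2 y.2 with hC
  have hCpos : C.PosSemidef := by
    have h1 := hT.completelyPositive (Fintype.card n)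
      (Matrix.of fun i j => condExpect M (Matrix.single (e.symm i) (e.symm j) 1))
      (posSemidef_choi_condExpect M e.symm)
    have h2 := h1.submatrix fun x : n × k => (e x.1, x.2)
    convert h2 using 1
    ext x y
    simp [hC]
  set B := psdPow C (1 / 2)
  have hB : ∀ x y, ∑ p, B x p * star (B y p) = C x y := by
    intro x y
    rw [← psdPow_half_mul_psdPow_half hCpos, Matrix.mul_apply]
    refine Finset.sum_congr rfl fun p _ => ?_
    rw [← Matrix.conjTranspose_apply, conjTranspose_psdPow]
  refine ⟨Matrix.of fun x i => B (i, x.1) x.2, ?_, fun ω => ?_⟩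
  · ext j i
    -- The isometry property is trace preservation evaluated on matrix units.
    have h1 : (∑ a, C (i, a) (j, a)) = if i = j then 1 else 0 := by
      have h2 := (hT.tracePreserving (condExpect M (Matrix.single i j 1))).trans
        (trace_condExpect M _)
      rw [Matrix.trace] at h2
      simp only [hC, Matrix.of_apply]
      refine h2.trans ?_
      by_cases h : i = j
      · simp [h]
      · simp [h, Matrix.trace_single_eq_of_ne]
    rw [Matrix.mul_apply, Fintype.sum_prod_type]
    simp only [Matrix.conjTranspose_apply, Matrix.of_apply, mul_comm (star _), hB, h1,
      Matrix.one_apply, eq_comm]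
  · have h1 : (T ω : Matrix k k ℂ) = ∑ i, ∑ j, (ω : Matrix n n ℂ) i j •
        (T (condExpect M (Matrix.single i j 1)) : Matrix k k ℂ) := by
      conv_lhs => rw [← condExpect_coe M ω, Matrix.matrix_eq_sum_single (ω : Matrix n n ℂ)]
      simp only [map_sum, AddSubmonoidClass.coe_finsetSum]
      refine Finset.sum_congr rfl fun i _ => Finset.sum_congr rfl fun j _ => ?_
      have h2 : Matrix.single i j ((ω : Matrix n n ℂ) i j) =
          (ω : Matrix n n ℂ) i j • Matrix.single i j (1 : ℂ) := by simp
      rw [h2, map_smul, map_smul]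
      rfl
    ext a b
    have h2 : ∀ i j, (T (condExpect M (Matrix.single i j 1)) : Matrix k k ℂ) a b =
        ∑ p, B (i, a) p * star (B (j, b) p) := fun i j => (hB (i, a) (j, b)).symm
    simp only [h1, Matrix.sum_apply, Matrix.smul_apply, h2, partialTrace, Matrix.of_apply,
      Matrix.mul_apply, Matrix.conjTranspose_apply, smul_eq_mul, Finset.mul_sum, Finset.sum_mul]
    rw [Finset.sum_comm]
    simp_rw [Finset.sum_comm (s := (Finset.univ : Finset n)) (t := (Finset.univ : Finset (n × k)))]
    refine Finset.sum_congr rfl fun p _ => Finset.sum_congr rfl fun j _ =>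
      Finset.sum_congr rfl fun i _ => ?_
    ring

end Stinespring

/-! ### Entropy bound and recovery error -/

section Bounds

variable {n k v : Type*} [Fintype n] [DecidableEq n] [Fintype k] [DecidableEq k] [Fintype v]
  [DecidableEq v]

theorem compress_le_smul (V : Matrix (k × v) n ℂ) {σ ρ : Matrix n n ℂ} {c : ℝ}
    (h : ((c : ℂ) • σ - ρ).PosSemidef) :
    ((c : ℂ) • partialTrace (V * σ * Vᴴ) - partialTrace (V * ρ * Vᴴ)).PosSemidef := by
  have h1 := posSemidef_partialTrace (h.mul_mul_conjTranspose_same V)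
  rwa [Matrix.mul_sub, Matrix.sub_mul, Matrix.mul_smul, Matrix.smul_mul, partialTrace_sub,
    partialTrace_smul] at h1

/-- Support inclusion passes through the compression in the form of domination, which conjugation
and the partial trace preserve. -/
theorem mul_kerProj_compress (V : Matrix (k × v) n ℂ) {σ ρ : Matrix n n ℂ} (hσ : σ.PosSemidef)
    (hρ : ρ.PosSemidef) (h : ρ * kerProj σ = 0) :
    partialTrace (V * ρ * Vᴴ) * kerProj (partialTrace (V * σ * Vᴴ)) = 0 :=
  mul_eq_zero_of_le_smul (posSemidef_partialTrace (hρ.mul_mul_conjTranspose_same V))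
    (compress_le_smul V (posSemidef_opNorm_gam_smul_sub hσ hρ h))
    (mul_kerProj (posSemidef_partialTrace (hσ.mul_mul_conjTranspose_same V)).1)

/-- The relation `ρ ≤ ‖Γ‖ σ` survives the compression, and conjugating it by the inverse root of the
compressed `σ` bounds `Γ_T` by `‖Γ‖`. -/
theorem spectrum_gam_compress_le (V : Matrix (k × v) n ℂ) {σ ρ : Matrix n n ℂ} (hσ : σ.PosSemidef)
    (hρ : ρ.PosSemidef) (h : ρ * kerProj σ = 0) {x : ℝ}
    (hx : x ∈ spectrum ℝ (gam (partialTrace (V * σ * Vᴴ)) (partialTrace (V * ρ * Vᴴ)))) :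
    x ≤ opNorm (gam σ ρ) :=
  spectrum_le (gam_le_of_le_smul (opNorm_nonneg _)
    (posSemidef_partialTrace (hσ.mul_mul_conjTranspose_same V))
    (compress_le_smul V (posSemidef_opNorm_gam_smul_sub hσ hρ h))) hx

theorem trace_compress {V : Matrix (k × v) n ℂ} (hV : Vᴴ * V = 1) (σ : Matrix n n ℂ) :
    (partialTrace (V * σ * Vᴴ)).trace = σ.trace := by
  rw [trace_partialTrace, Matrix.trace_mul_comm, ← Matrix.mul_assoc, hV, Matrix.one_mul]

/-- The square-root gap of an isometric dilation is controlled by the gap of BS-entropies. -/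
theorem pow_four_sqrt_gap_le_bsFormula_sub {σ ρ : Matrix n n ℂ} (hσ : σ.PosSemidef)
    (hρ : ρ.PosSemidef) (h : ρ * kerProj σ = 0) (h' : σ * kerProj ρ = 0) (htr : σ.trace = 1)
    {V : Matrix (k × v) n ℂ} (hV : Vᴴ * V = 1) :
    (Real.pi * ‖vec (funcGap (V * psdPow σ (1 / 2)) (gam σ ρ) (partialTrace (V * σ * Vᴴ))
        (partialTrace (V * ρ * Vᴴ)) Real.sqrt)‖) ^ 4 ≤
      256 * opNorm (gam σ ρ) ^ 2 * (bsFormula σ ρ -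
        bsFormula (partialTrace (V * σ * Vᴴ)) (partialTrace (V * ρ * Vᴴ))) := by
  have hτ := posSemidef_partialTrace (hσ.mul_mul_conjTranspose_same V)
  have hθ := posSemidef_partialTrace (hρ.mul_mul_conjTranspose_same V)
  have hss := psdPow_half_mul_psdPow_half hσ
  have hUX : ∀ X, V * psdPow σ (1 / 2) * X * (V * psdPow σ (1 / 2))ᴴ =
      V * (psdPow σ (1 / 2) * X * psdPow σ (1 / 2)) * Vᴴ := fun X => by
    rw [Matrix.conjTranspose_mul, conjTranspose_psdPow]
    simp only [Matrix.mul_assoc]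
  have hU : V * psdPow σ (1 / 2) * (V * psdPow σ (1 / 2))ᴴ = V * σ * Vᴴ := by
    have := hUX 1
    rwa [Matrix.mul_one, Matrix.mul_one, hss] at this
  have hUΓ := hUX (gam σ ρ)
  rw [psdPow_half_mul_gam_mul_psdPow_half hσ hρ h] at hUΓ
  have hlog : (V * psdPow σ (1 / 2) * cfc Real.log (gam σ ρ) * (V * psdPow σ (1 / 2))ᴴ).trace =
      (σ * cfc Real.log (gam σ ρ)).trace := by
    rw [hUX, Matrix.trace_mul_comm, ← Matrix.mul_assoc, hV, Matrix.one_mul, Matrix.trace_mul_comm,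
      ← Matrix.mul_assoc, hss]
  have key := pow_four_funcGap_sqrt_le (U := V * psdPow σ (1 / 2)) (posSemidef_gam (σ := σ) hρ)
    hτ hθ (by rw [hU]) (by rw [hUΓ]) (mul_kerProj_compress V hσ hρ h)
    (by rw [trace_compress hV, htr, Complex.one_re]) (opNorm_nonneg (gam σ ρ))
    (fun x hx => spectrum_le_opNorm hx) (fun x hx => spectrum_gam_compress_le V hσ hρ h hx)
    (fun B hB => by
      have h1 := mul_eq_zero_of_gam_mul_eq_zero hσ hρ h
        (posSemidef_opNorm_gam_smul_sub hρ hσ h') hB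
      rw [Matrix.mul_assoc, (psdPow_half_mul_eq_zero_iff hσ).2 h1, Matrix.mul_zero])
    (fun B hB => mul_eq_zero_of_gam_mul_eq_zero hτ hθ (mul_kerProj_compress V hσ hρ h)
      (compress_le_smul V (posSemidef_opNorm_gam_smul_sub hρ hσ h')) hB)
  rw [hlog] at key
  refine key.trans (le_of_eq ?_)
  rw [bsFormula, bsFormula]
  ring

theorem opNorm_gam_pos {σ ρ : Matrix n n ℂ} (hσ : σ.PosSemidef) (hρ : ρ.PosSemidef)
    (h : ρ * kerProj σ = 0) (htr : ρ.trace = 1) : 0 < opNorm (gam σ ρ) := by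
  refine (opNorm_nonneg _).lt_of_ne fun h0 => ?_
  have h1 := re_trace_nonneg (posSemidef_opNorm_gam_smul_sub hσ hρ h)
  rw [← h0, Complex.ofReal_zero, zero_smul, zero_sub, Matrix.trace_neg, htr, Complex.neg_re,
    Complex.one_re] at h1
  linarith

theorem psdPow_half_eq_cfc_sqrt (A : Matrix n n ℂ) : psdPow A (1 / 2) = cfc Real.sqrt A := by
  rw [psdPow]
  congr 1
  funext x
  rw [Real.sqrt_eq_rpow]

/-- The operator on the left is `-V` times the adjoint of the gap; adjoints, signs and isometries
preserve the Hilbert-Schmidt norm. -/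
theorem hsNorm_dilation_gap {V : Matrix (k × v) n ℂ} (hV : Vᴴ * V = 1) (σ ρ : Matrix n n ℂ)
    (τ θ : Matrix k k ℂ) :
    hsNorm (V * psdPow σ (1 / 2) * Vᴴ *
        ((psdPow τ (-1 / 2) * psdPow (gam τ θ) (1 / 2) * psdPow τ (1 / 2)) ⊗ₖ
          (1 : Matrix v v ℂ)) - V * psdPow (gam σ ρ) (1 / 2) * psdPow σ (1 / 2) * Vᴴ) =
      ‖vec (funcGap (V * psdPow σ (1 / 2)) (gam σ ρ) τ θ Real.sqrt)‖ := by
  have h1 : V * psdPow σ (1 / 2) * Vᴴ *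
        ((psdPow τ (-1 / 2) * psdPow (gam τ θ) (1 / 2) * psdPow τ (1 / 2)) ⊗ₖ
          (1 : Matrix v v ℂ)) - V * psdPow (gam σ ρ) (1 / 2) * psdPow σ (1 / 2) * Vᴴ =
      -(V * (funcGap (V * psdPow σ (1 / 2)) (gam σ ρ) τ θ Real.sqrt)ᴴ) := by
    rw [funcGap, Matrix.conjTranspose_sub, Matrix.conjTranspose_mul, Matrix.conjTranspose_mul,
      Matrix.conjTranspose_mul, Matrix.conjTranspose_mul, conjTranspose_kronecker_one,
      Matrix.conjTranspose_mul, Matrix.conjTranspose_mul, conjTranspose_psdPow,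
      conjTranspose_psdPow, conjTranspose_psdPow, conjTranspose_cfc, conjTranspose_cfc,
      psdPow_half_eq_cfc_sqrt (gam τ θ), psdPow_half_eq_cfc_sqrt (gam σ ρ)]
    simp only [Matrix.mul_sub, Matrix.mul_assoc, neg_sub]
  rw [h1, hsNorm_eq_norm_vec, map_neg, norm_neg, norm_vec_isometry_mul hV, norm_vec_conjTranspose]

theorem bsFormula_sub_ge {σ ρ : Matrix n n ℂ} (hσ : σ.PosSemidef)
    (hρ : ρ.PosSemidef) (h : ρ * kerProj σ = 0) (h' : σ * kerProj ρ = 0) (hσtr : σ.trace = 1)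
    (hρtr : ρ.trace = 1) {V : Matrix (k × v) n ℂ} (hV : Vᴴ * V = 1) :
    (Real.pi / 4) ^ 4 * opNorm (gam σ ρ) ^ (-2 : ℤ) *
        ‖vec (funcGap (V * psdPow σ (1 / 2)) (gam σ ρ) (partialTrace (V * σ * Vᴴ))
        (partialTrace (V * ρ * Vᴴ)) Real.sqrt)‖ ^ 4 ≤
      bsFormula σ ρ - bsFormula (partialTrace (V * σ * Vᴴ)) (partialTrace (V * ρ * Vᴴ)) := by
  have hL := opNorm_gam_pos hσ hρ h hρtr
  have key := pow_four_sqrt_gap_le_bsFormula_sub hσ hρ h h' hσtr hV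
  set L := opNorm (gam σ ρ)
  set N := ‖vec (funcGap (V * psdPow σ (1 / 2)) (gam σ ρ) (partialTrace (V * σ * Vᴴ))
        (partialTrace (V * ρ * Vᴴ)) Real.sqrt)‖
  have h1 : (Real.pi / 4) ^ 4 * L ^ (-2 : ℤ) * N ^ 4 = (Real.pi * N) ^ 4 / (256 * L ^ 2) := by
    rw [zpow_neg]
    norm_cast
    field_simp
    norm_num
    ring
  rw [h1, div_le_iff₀' (by positivity)]
  exact key

theorem spectrum_le_one_of_trace_eq_one {σ : Matrix n n ℂ} (hσ : σ.PosSemidef)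
    (htr : σ.trace = 1) {x : ℝ} (hx : x ∈ spectrum ℝ σ) : x ≤ 1 := by
  obtain ⟨i, rfl⟩ := hσ.1.spectrum_real_eq_range_eigenvalues ▸ hx
  have h1 : ∑ i, hσ.1.eigenvalues i = 1 := by
    have := hσ.1.trace_eq_sum_eigenvalues
    rw [htr] at this
    simpa using (congrArg Complex.re this).symm
  rw [← h1]
  exact Finset.single_le_sum (fun j _ => hσ.eigenvalues_nonneg j) (Finset.mem_univ i)

/-- A state has a nonzero eigenvalue, and it is at most `1`. This lets the recovery estimate absorb
the term without `‖τ⁻¹‖` into the term with it. -/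
theorem one_le_opNorm_mpInv {τ : Matrix k k ℂ} (hτ : τ.PosSemidef) (htr : τ.trace = 1) :
    1 ≤ opNorm (mpInv τ) := by
  have h1 : ∃ x ∈ spectrum ℝ τ, x ≠ 0 := by
    by_contra! h0
    have : τ = 0 := by
      rw [← cfc_id' ℝ τ hτ.1.isSelfAdjoint, ← cfc_zero ℝ τ]
      exact cfc_congr fun x hx => h0 x hx
    rw [this, Matrix.trace_zero] at htr
    exact zero_ne_one htr
  obtain ⟨x, hx, hx0⟩ := h1
  have hx1 := spectrum_le_one_of_trace_eq_one hτ htr hx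
  have hxpos : 0 < x := lt_of_le_of_ne (spectrum_nonneg hτ hx) (Ne.symm hx0)
  have h2 : x⁻¹ ∈ spectrum ℝ (mpInv τ) := by
    rw [mpInv, cfc_map_spectrum (fun x : ℝ => x⁻¹) τ hτ.1.isSelfAdjoint (continuousOn_spectrum _ _)]
    exact ⟨x, hx, rfl⟩
  exact ((one_le_inv₀ hxpos).2 hx1).trans (spectrum_le_opNorm h2)

theorem posSemidef_smul_one_sub {A : Matrix n n ℂ} (hA : A.IsHermitian) {c : ℝ}
    (h : ∀ x ∈ spectrum ℝ A, x ≤ c) : ((c : ℂ) • (1 : Matrix n n ℂ) - A).PosSemidef := by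
  rw [smul_one_sub_eq_cfc hA]
  exact posSemidef_cfc fun x hx => sub_nonneg.2 (h x hx)

theorem posSemidef_smul_one_sub_kronecker {B : Matrix k k ℂ} {c : ℝ}
    (h : ((c : ℂ) • (1 : Matrix k k ℂ) - B * Bᴴ).PosSemidef) :
    ((c : ℂ) • (1 : Matrix (k × v) (k × v) ℂ) -
      (B ⊗ₖ (1 : Matrix v v ℂ)) * (B ⊗ₖ (1 : Matrix v v ℂ))ᴴ).PosSemidef := by
  have h1 := h.kronecker (Matrix.PosSemidef.one (n := v) (R := ℂ))
  rwa [sub_kronecker_one, Matrix.smul_kronecker, Matrix.one_kronecker_one, kronecker_one_mul,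
    ← conjTranspose_kronecker_one] at h1

/-- The recovery error is controlled by the square-root gap. -/
theorem norm_vec_recovery_le {σ ρ : Matrix n n ℂ} (hσ : σ.PosSemidef)
    (hρ : ρ.PosSemidef) (h : ρ * kerProj σ = 0) (hσtr : σ.trace = 1) {V : Matrix (k × v) n ℂ}
    (hV : Vᴴ * V = 1) {τ θ : Matrix k k ℂ} (hτ : partialTrace (V * σ * Vᴴ) = τ)
    (hθ : partialTrace (V * ρ * Vᴴ) = θ) :
    ‖vec (ρ - σ * (Vᴴ * ((mpInv τ * θ) ⊗ₖ (1 : Matrix v v ℂ)) * V))‖ ≤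
      2 * √(opNorm (gam σ ρ)) * √(opNorm (mpInv τ)) *
        ‖vec (funcGap (V * psdPow σ (1 / 2)) (gam σ ρ) τ θ Real.sqrt)‖ := by
  have hτpos : τ.PosSemidef := hτ ▸ posSemidef_partialTrace (hσ.mul_mul_conjTranspose_same V)
  have hθpos : θ.PosSemidef := hθ ▸ posSemidef_partialTrace (hρ.mul_mul_conjTranspose_same V)
  have hτtr : τ.trace = 1 := by rw [← hτ, trace_compress hV, hσtr]
  have hθτ : θ * kerProj τ = 0 := hτ ▸ hθ ▸ mul_kerProj_compress V hσ hρ h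
  have hGle : ∀ x ∈ spectrum ℝ (gam τ θ), x ≤ opNorm (gam σ ρ) := fun x hx => by
    subst hτ hθ
    exact spectrum_gam_compress_le V hσ hρ h hx
  have ht := one_le_opNorm_mpInv hτpos hτtr
  set L := opNorm (gam σ ρ) with hLdef
  set t := opNorm (mpInv τ) with htdef
  set u := psdPow σ (1 / 2) with hu
  set G := cfc Real.sqrt (gam σ ρ) with hG
  set g := cfc Real.sqrt (gam τ θ) with hg
  set s := psdPow τ (1 / 2) with hs
  set r := psdPow τ (-1 / 2) with hr
  have hL0 : 0 ≤ L := opNorm_nonneg _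
  have hu' : uᴴ = u := conjTranspose_psdPow _ _
  have hs' : sᴴ = s := conjTranspose_psdPow _ _
  have hr' : rᴴ = r := conjTranspose_psdPow _ _
  have hg' : gᴴ = g := conjTranspose_cfc _ _
  have hG' : Gᴴ = G := conjTranspose_cfc _ _
  have huu : u * u = σ := psdPow_half_mul_psdPow_half hσ
  have hGG : G * G = gam σ ρ := by
    rw [hG, ← psdPow_half_eq_cfc_sqrt, psdPow_half_mul_psdPow_half (posSemidef_gam hρ)]
  have hgg : g * g = gam τ θ := by
    rw [hg, ← psdPow_half_eq_cfc_sqrt, psdPow_half_mul_psdPow_half (posSemidef_gam hθpos)]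
  have hsr : s * r = suppProj τ := psdPow_half_mul_psdPow_neg_half hτpos
  have hrs : r * s = suppProj τ := psdPow_neg_half_mul_psdPow_half hτpos
  have hrr : r * r = mpInv τ := psdPow_neg_half_mul_psdPow_neg_half hτpos
  have hss : s * s = τ := psdPow_half_mul_psdPow_half hτpos
  -- A square root, in general not Hermitian, of `τ⁻¹ θ`.
  set b := r * g * s with hb
  have hbb : b * b = mpInv τ * θ := by
    calc b * b = r * (g * (s * r)) * g * s := by rw [hb]; simp only [Matrix.mul_assoc]
      _ = (r * suppProj τ) * (g * g) * s := by
          rw [hsr, hg, cfc_gam_mul_suppProj hθpos]; simp only [Matrix.mul_assoc]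
      _ = (r * r) * θ * (r * s) := by
          rw [hgg, psdPow_mul_suppProj τ (by norm_num), gam]; simp only [Matrix.mul_assoc, ← hr]
      _ = _ := by rw [hrr, hrs, Matrix.mul_assoc, mul_suppProj_of_mul_kerProj hτpos.1 hθτ]
  set K := b ⊗ₖ (1 : Matrix v v ℂ) with hK
  set W := funcGap (V * u) (gam σ ρ) τ θ Real.sqrt with hW
  have hWadj : Wᴴ = G * (u * Vᴴ) - u * Vᴴ * K := by
    rw [hW, funcGap, Matrix.conjTranspose_sub, Matrix.conjTranspose_mul, Matrix.conjTranspose_mul,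
      Matrix.conjTranspose_mul, conjTranspose_kronecker_one, Matrix.conjTranspose_mul,
      Matrix.conjTranspose_mul, Matrix.conjTranspose_mul, ← hG, ← hg, ← hs, ← hr, hu', hs', hr',
      hg', hG', hK, hb, Matrix.mul_assoc r]
  -- With `Y = σ^{1/2} V*` and `Wᴴ = G Y - Y K`, this is the difference of squares `G² Y - Y K² = G
  -- (G Y - Y K) + (G Y - Y K) K`.
  have hmain : ρ - σ * (Vᴴ * ((mpInv τ * θ) ⊗ₖ (1 : Matrix v v ℂ)) * V) =
      u * ((G * Wᴴ + Wᴴ * K) * V) := by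
    have h1 : u * (G * (G * (u * Vᴴ)) * V) = ρ := by
      calc u * (G * (G * (u * Vᴴ)) * V) = u * (G * G) * u * (Vᴴ * V) := by
            simp only [Matrix.mul_assoc]
        _ = ρ := by
            rw [hGG, hV, Matrix.mul_one, psdPow_half_mul_gam_mul_psdPow_half hσ hρ h]
    have h2 : u * (u * Vᴴ * K * K * V) =
        σ * (Vᴴ * ((mpInv τ * θ) ⊗ₖ (1 : Matrix v v ℂ)) * V) := by
      calc u * (u * Vᴴ * K * K * V) = (u * u) * (Vᴴ * (K * K) * V) := by
            simp only [Matrix.mul_assoc]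
        _ = _ := by rw [huu, hK, ← kronecker_one_mul, hbb]
    have h3 : G * Wᴴ + Wᴴ * K = G * (G * (u * Vᴴ)) - u * Vᴴ * K * K := by
      rw [hWadj, Matrix.mul_sub, Matrix.sub_mul, Matrix.mul_assoc G _ K]
      abel
    rw [h3, Matrix.sub_mul, Matrix.mul_sub, h1, h2]
  have hNadj : ‖vec Wᴴ‖ = ‖vec W‖ := norm_vec_conjTranspose W
  have b1 : ‖vec (u * ((G * Wᴴ + Wᴴ * K) * V))‖ ≤ 1 * ‖vec ((G * Wᴴ + Wᴴ * K) * V)‖ := by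
    refine norm_vec_mul_le' _ zero_le_one ?_
    rw [hu', huu, one_pow]
    exact posSemidef_smul_one_sub hσ.1 fun x hx => spectrum_le_one_of_trace_eq_one hσ hσtr hx
  have b2 : ‖vec ((G * Wᴴ + Wᴴ * K) * V)‖ ≤ 1 * ‖vec (G * Wᴴ + Wᴴ * K)‖ := by
    refine norm_vec_mul_le _ zero_le_one ?_
    have h1 : (((1 ^ 2 : ℝ) : ℂ) • (1 : Matrix (k × v) (k × v) ℂ) - V * Vᴴ) =
        (1 - V * Vᴴ)ᴴ * (1 - V * Vᴴ) := by
      have h2 : V * Vᴴ * (V * Vᴴ) = V * Vᴴ := by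
        rw [Matrix.mul_assoc, ← Matrix.mul_assoc Vᴴ, hV, Matrix.one_mul]
      simp [Matrix.conjTranspose_sub, Matrix.mul_sub, Matrix.sub_mul, h2]
    rw [h1]
    exact Matrix.posSemidef_conjTranspose_mul_self _
  have b3 : ‖vec (G * Wᴴ)‖ ≤ √L * ‖vec Wᴴ‖ := by
    refine norm_vec_mul_le' _ (Real.sqrt_nonneg _) ?_
    rw [hG', hGG, Real.sq_sqrt hL0]
    exact posSemidef_opNorm_smul_one_sub (posSemidef_gam hρ).1
  -- The factors `r`, `g`, `s` of `K` contribute at most `√t`, `√L` and `1`, the last because `τ` is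
  -- a state.
  have b4 : ‖vec (Wᴴ * K)‖ ≤ 1 * (√L * (√t * ‖vec Wᴴ‖)) := by
    have h1 : Wᴴ * K = Wᴴ * (r ⊗ₖ (1 : Matrix v v ℂ)) * (g ⊗ₖ (1 : Matrix v v ℂ)) *
        (s ⊗ₖ (1 : Matrix v v ℂ)) := by
      rw [hK, hb, kronecker_one_mul, kronecker_one_mul]
      simp only [Matrix.mul_assoc]
    rw [h1]
    refine (norm_vec_mul_le _ zero_le_one (posSemidef_smul_one_sub_kronecker ?_)).trans
      (mul_le_mul_of_nonneg_left ?_ zero_le_one)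
    · rw [hs', hss, one_pow]
      exact posSemidef_smul_one_sub hτpos.1
        fun x hx => spectrum_le_one_of_trace_eq_one hτpos hτtr hx
    refine (norm_vec_mul_le _ (Real.sqrt_nonneg L) (posSemidef_smul_one_sub_kronecker ?_)).trans
      (mul_le_mul_of_nonneg_left ?_ (Real.sqrt_nonneg _))
    · rw [hg', hgg, Real.sq_sqrt hL0]
      exact posSemidef_smul_one_sub (posSemidef_gam hθpos).1 hGle
    refine norm_vec_mul_le _ (Real.sqrt_nonneg t) (posSemidef_smul_one_sub_kronecker ?_)
    rw [hr', hrr, Real.sq_sqrt (zero_le_one.trans ht)]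
    exact posSemidef_opNorm_smul_one_sub (isHermitian_cfc _ _)
  have b5 : ‖vec (G * Wᴴ + Wᴴ * K)‖ ≤ ‖vec (G * Wᴴ)‖ + ‖vec (Wᴴ * K)‖ := by
    rw [map_add]
    exact norm_add_le _ _
  have b6 : √L * ‖vec W‖ ≤ √L * √t * ‖vec W‖ := by
    have : 1 ≤ √t := Real.one_le_sqrt.2 ht
    have h0 : 0 ≤ √L * ‖vec W‖ := by positivity
    nlinarith
  rw [hmain]
  rw [hNadj] at b3 b4
  linarith

/-- Replacing the adjoint of the full channel by that of its restriction to `M` does not increase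
the recovery error. -/
theorem hsNorm_recovery_le {M : StarSubalgebra ℂ (Matrix n n ℂ)} {N : StarSubalgebra ℂ (Matrix k k ℂ)}
    {T : M →ₗ[ℂ] N} {V : Matrix (k × v) n ℂ}
    (hTV : ∀ ω : M, (T ω : Matrix k k ℂ) = partialTrace (V * (ω : Matrix n n ℂ) * Vᴴ)) (σ ρ : M)
    (hσ : (σ : Matrix n n ℂ).IsHermitian) (Y : N) :
    hsNorm ((σ : Matrix n n ℂ) * (hsAdjoint T Y : Matrix n n ℂ) - (ρ : Matrix n n ℂ)) ≤
      ‖vec ((ρ : Matrix n n ℂ) - (σ : Matrix n n ℂ) *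
        (Vᴴ * ((Y : Matrix k k ℂ) ⊗ₖ (1 : Matrix v v ℂ)) * V))‖ := by
  set X : M := σ * hsAdjoint T Y - ρ with hX
  set R : Matrix n n ℂ := (σ : Matrix n n ℂ) * (Vᴴ * ((Y : Matrix k k ℂ) ⊗ₖ (1 : Matrix v v ℂ)) * V)
    with hR
  have hXc : (σ : Matrix n n ℂ) * (hsAdjoint T Y : Matrix n n ℂ) - (ρ : Matrix n n ℂ) = X := rfl
  -- Both `X` and `σ X` lie in `M`, so the defining relation of the adjoint may be tested on `σ X`.
  -- It makes `R - σ T*(Y)` orthogonal to `X`, and Cauchy-Schwarz then bounds `‖X‖` by `‖R - ρ‖`.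
  have h1 : ((X : Matrix n n ℂ)ᴴ * ((σ : Matrix n n ℂ) * (hsAdjoint T Y : Matrix n n ℂ))).trace =
      ((X : Matrix n n ℂ)ᴴ * R).trace := by
    have h2 := hsAdjoint_spec T Y (σ * X)
    rw [hTV, MulMemClass.coe_mul, ← partialTrace_kronecker_mul, trace_partialTrace] at h2
    have h3 := congrArg star h2
    rw [← Matrix.trace_conjTranspose, ← Matrix.trace_conjTranspose] at h3
    simp only [Matrix.conjTranspose_mul, Matrix.conjTranspose_conjTranspose,
      conjTranspose_kronecker_one, hσ.eq] at h3
    rw [← Matrix.mul_assoc, h3, hR]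
    rw [Matrix.mul_assoc V, Matrix.trace_mul_comm]
    simp only [Matrix.mul_assoc]
  have h5 : inner ℂ (vec (X : Matrix n n ℂ)) (vec (X : Matrix n n ℂ)) =
      inner ℂ (vec (X : Matrix n n ℂ)) (vec (R - (ρ : Matrix n n ℂ))) := by
    rw [inner_vec, inner_vec, Matrix.mul_sub, Matrix.trace_sub, ← h1, ← Matrix.trace_sub,
      ← Matrix.mul_sub, hXc]
  have h6 : ‖vec (X : Matrix n n ℂ)‖ * ‖vec (X : Matrix n n ℂ)‖ ≤
      ‖vec (X : Matrix n n ℂ)‖ * ‖vec (R - (ρ : Matrix n n ℂ))‖ := by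
    have := norm_inner_le_norm (𝕜 := ℂ) (vec (X : Matrix n n ℂ)) (vec (R - (ρ : Matrix n n ℂ)))
    rwa [← h5, inner_self_eq_norm_sq_to_K, norm_pow, RCLike.norm_ofReal, abs_norm, sq] at this
  rw [hXc, hsNorm_eq_norm_vec, ← norm_neg (vec ((ρ : Matrix n n ℂ) - R)), ← map_neg, neg_sub]
  rcases (norm_nonneg (vec (X : Matrix n n ℂ))).eq_or_lt with h0 | h0
  · rw [← h0]
    exact norm_nonneg _
  · exact le_of_mul_le_mul_left h6 h0

end Bounds

end BSChannel

theorem theorem6p1 {n k : Type*} [Fintype n] [DecidableEq n] [Fintype k] [DecidableEq k]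
    (M : StarSubalgebra ℂ (Matrix n n ℂ)) (N : StarSubalgebra ℂ (Matrix k k ℂ))
    (T : M →ₗ[ℂ] N) (hT : BSChannel.IsQuantumChannel T) (σ ρ : M)
    (hσ : BSChannel.IsState (σ : Matrix n n ℂ)) (hρ : BSChannel.IsState (ρ : Matrix n n ℂ))
    (hsupp : BSChannel.support (ρ : Matrix n n ℂ) = BSChannel.support (σ : Matrix n n ℂ)) :
    -- the limits that define the two BS-entropies exist and are finite
    Filter.Tendsto (BSChannel.bsRegularized (σ : Matrix n n ℂ) (ρ : Matrix n n ℂ))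
      (𝓝[>] (0 : ℝ)) (𝓝 (BSChannel.bsEntropy (σ : Matrix n n ℂ) (ρ : Matrix n n ℂ))) ∧
    Filter.Tendsto (BSChannel.bsRegularized (T σ : Matrix k k ℂ) (T ρ : Matrix k k ℂ))
      (𝓝[>] (0 : ℝ)) (𝓝 (BSChannel.bsEntropy (T σ : Matrix k k ℂ) (T ρ : Matrix k k ℂ))) ∧
    -- first bound, for the isometry of an arbitrary Stinespring dilation
    (∀ (v : Type*) [Fintype v] [DecidableEq v] (V : Matrix (k × v) n ℂ),
      BSChannel.IsStinespringIsometry T V →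
      (Real.pi / 4) ^ 4 *
          BSChannel.opNorm (BSChannel.gam (σ : Matrix n n ℂ) (ρ : Matrix n n ℂ)) ^ (-2 : ℤ) *
          BSChannel.hsNorm
            (V * BSChannel.psdPow (σ : Matrix n n ℂ) (1 / 2) * Vᴴ *
              ((BSChannel.psdPow (T σ : Matrix k k ℂ) (-1 / 2) *
                  BSChannel.psdPow
                    (BSChannel.gam (T σ : Matrix k k ℂ) (T ρ : Matrix k k ℂ)) (1 / 2) *
                  BSChannel.psdPow (T σ : Matrix k k ℂ) (1 / 2)) ⊗ₖ (1 : Matrix v v ℂ)) -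
              V * BSChannel.psdPow
                    (BSChannel.gam (σ : Matrix n n ℂ) (ρ : Matrix n n ℂ)) (1 / 2) *
                BSChannel.psdPow (σ : Matrix n n ℂ) (1 / 2) * Vᴴ) ^ 4 ≤
        BSChannel.bsEntropy (σ : Matrix n n ℂ) (ρ : Matrix n n ℂ) -
          BSChannel.bsEntropy (T σ : Matrix k k ℂ) (T ρ : Matrix k k ℂ)) ∧
    -- second bound
    (Real.pi / 8) ^ 4 *
        BSChannel.opNorm (BSChannel.gam (σ : Matrix n n ℂ) (ρ : Matrix n n ℂ)) ^ (-4 : ℤ) *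
        BSChannel.opNorm (BSChannel.mpInv (T σ : Matrix k k ℂ)) ^ (-2 : ℤ) *
        BSChannel.hsNorm
          ((σ : Matrix n n ℂ) *
              (BSChannel.hsAdjoint T (BSChannel.mpInvIn (T σ) * T ρ) : Matrix n n ℂ) -
            (ρ : Matrix n n ℂ)) ^ 4 ≤
      BSChannel.bsEntropy (σ : Matrix n n ℂ) (ρ : Matrix n n ℂ) -
        BSChannel.bsEntropy (T σ : Matrix k k ℂ) (T ρ : Matrix k k ℂ) := by
  -- This dilation, valid on all of `M`, supplies positivity and support relations for the images
  -- and carries the second bound, whose statement mentions no dilation.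
  obtain ⟨V₀, hV₀, hTV₀⟩ := BSChannel.exists_stinespring hT
  have hk := BSChannel.mul_kerProj_of_support_le hσ.1 hsupp.le
  have hk' := BSChannel.mul_kerProj_of_support_le hρ.1 hsupp.ge
  have hTσ : (T σ : Matrix k k ℂ).PosSemidef := by
    rw [hTV₀]
    exact BSChannel.posSemidef_partialTrace (hσ.1.mul_mul_conjTranspose_same V₀)
  have hTρ : (T ρ : Matrix k k ℂ).PosSemidef := by
    rw [hTV₀]
    exact BSChannel.posSemidef_partialTrace (hρ.1.mul_mul_conjTranspose_same V₀)
  have hTk : (T ρ : Matrix k k ℂ) * BSChannel.kerProj (T σ : Matrix k k ℂ) = 0 := by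
    rw [hTV₀, hTV₀]
    exact BSChannel.mul_kerProj_compress V₀ hσ.1 hρ.1 hk
  have hTk' : (T σ : Matrix k k ℂ) * BSChannel.kerProj (T ρ : Matrix k k ℂ) = 0 := by
    rw [hTV₀, hTV₀]
    exact BSChannel.mul_kerProj_compress V₀ hρ.1 hσ.1 hk'
  rw [BSChannel.bsEntropy_eq_bsFormula hσ.1 hρ.1 hk hk',
    BSChannel.bsEntropy_eq_bsFormula hTσ hTρ hTk hTk']
  refine ⟨BSChannel.tendsto_bsRegularized hσ.1 hρ.1 hk hk',
    BSChannel.tendsto_bsRegularized hTσ hTρ hTk hTk', ?_, ?_⟩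
  · intro v _ _ V hV
    rw [BSChannel.hsNorm_dilation_gap hV.1, hV.2 σ hσ, hV.2 ρ hρ]
    exact BSChannel.bsFormula_sub_ge hσ.1 hρ.1 hk hk' hσ.2 hρ.2 hV.1
  · have h1 := BSChannel.bsFormula_sub_ge hσ.1 hρ.1 hk hk' hσ.2 hρ.2 hV₀
    have h2 := (BSChannel.hsNorm_recovery_le hTV₀ σ ρ hσ.1.1
      (BSChannel.mpInvIn (T σ) * T ρ)).trans
      (BSChannel.norm_vec_recovery_le hσ.1 hρ.1 hk hσ.2 hV₀ (hTV₀ σ).symm (hTV₀ ρ).symm)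
    rw [← hTV₀ σ, ← hTV₀ ρ] at h1
    have hL := BSChannel.opNorm_gam_pos hσ.1 hρ.1 hk hρ.2
    have hTtr : (T σ : Matrix k k ℂ).trace = 1 := by rw [hT.tracePreserving, hσ.2]
    have ht := zero_lt_one.trans_le (BSChannel.one_le_opNorm_mpInv hTσ hTtr)
    refine le_trans ?_ h1
    set L := BSChannel.opNorm (BSChannel.gam (σ : Matrix n n ℂ) (ρ : Matrix n n ℂ))
    set t := BSChannel.opNorm (BSChannel.mpInv (T σ : Matrix k k ℂ))
    set X := BSChannel.hsNorm ((σ : Matrix n n ℂ) *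
      (BSChannel.hsAdjoint T (BSChannel.mpInvIn (T σ) * T ρ) : Matrix n n ℂ) - (ρ : Matrix n n ℂ))
    set W := ‖BSChannel.vec (BSChannel.funcGap
      (V₀ * BSChannel.psdPow (σ : Matrix n n ℂ) (1 / 2))
      (BSChannel.gam (σ : Matrix n n ℂ) (ρ : Matrix n n ℂ)) (T σ : Matrix k k ℂ)
      (T ρ : Matrix k k ℂ) Real.sqrt)‖
    have hX : X ^ 4 ≤ 16 * L ^ 2 * t ^ 2 * W ^ 4 := by
      calc X ^ 4 ≤ (2 * √L * √t * W) ^ 4 := pow_le_pow_left₀ (Real.sqrt_nonneg _) h2 4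
        _ = 16 * (√L ^ 2) ^ 2 * (√t ^ 2) ^ 2 * W ^ 4 := by ring
        _ = _ := by rw [Real.sq_sqrt hL.le, Real.sq_sqrt ht.le]
    -- The constants match because `16 = (8 / 4)⁴`.
    calc (Real.pi / 8) ^ 4 * L ^ (-4 : ℤ) * t ^ (-2 : ℤ) * X ^ 4
        ≤ (Real.pi / 8) ^ 4 * L ^ (-4 : ℤ) * t ^ (-2 : ℤ) * (16 * L ^ 2 * t ^ 2 * W ^ 4) := by
          gcongr
      _ = (Real.pi / 4) ^ 4 * L ^ (-2 : ℤ) * W ^ 4 := by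
          rw [zpow_neg, zpow_neg, zpow_neg]
          norm_cast
          field_simp
          norm_num
          ring
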